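/- Fix $N\ge 0$. Let $\mathcal A=\{1,\dots,N\}\sqcup\{\bar 1,\dots,\bar N\}$ (unbarred and barred letters), let $\mathcal U$ be the free associative $\mathbb Z$-algebra on the variables $u_z$, $z\in\mathcal A$, and identify its monomials with words $w=w_1\cdots w_t$ in $\mathcal A$ (colored words), so that $x$ also stands for $u_x$. Let $\langle\cdot,\cdot\rangle$ be the bilinear form on $\mathcal U$ for which the words are orthonormal, and for a two-sided ideal $I$ put $I^\perp=\{\gamma\in\mathcal U:\langle f,\gamma\rangle=0\ \forall f\in I\}$. A *shuffle order* is a total order $\lessdot$ on $\mathcal A$ with $1\lessdot\cdots\lessdot N$ and $\bar 1\lessdot\cdots\lessdot\bar N$; the *natural order* $<$ is $1<\bar 1<2<\bar 2<\cdots<N<\bar N$, and $z\!\downarrow$ denotes the immediate predecessor of $z$ in the natural order (when it exists). For a shuffle order $\lessdot$ and $k\ge 0$ let $e_k(\mathbf u)=\sum u_{z_1}\cdots u_{z_k}$ over all $z_1,\dots,z_k\in\mathcal A$ such that for each $i<k$ either $z_i\gtrdot z_{i+1}$ or $z_i=z_{i+1}$ is barred, and let $h_k(\mathbf u)=\sum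 u_{z_1}\cdots u_{z_k}$ over those such that for each $i<k$ either $z_i\lessdot z_{i+1}$ or $z_i=z_{i+1}$ is unbarred; $e_0=h_0=1$ and $e_k=0$ for $k<0$. For a partition $\nu$ with conjugate $\nu'$ and $t=\nu_1$, let $$\mathfrak J_\nu(\mathbf u)=\sum_{\pi\in S_t}\operatorname{sgn}(\pi)\,e_{\nu'_1+\pi(1)-1}(\mathbf u)\cdots e_{\nu'_t+\pi(t)-t}(\mathbf u)\in\mathcal U .$$ For a word $w=w_1\cdots w_t$ let $\mathrm{Des}(w)$ be the set of $i\in\{1,\dots,t-1\}$ such that $w_i\gtrdot w_{i+1}$ or $w_i=w_{i+1}$ is barred, and let $Q_{\mathrm{Des}(w)}(\mathbf x)=\sum x_{i_1}\cdots x_{i_t}$ over $1\le i_1\le\cdots\le i_t$ with $i_j<i_{j+1}$ for $j\in\mathrm{Des}(w)$. For $\gamma=\sum_w\gamma_w w\in\mathcal U$ put $F^\lessdot_\gamma(\mathbf x)=\sum_w\gamma_w Q_{\mathrm{Des}(w)}(\mathbf x)\in\mathbb Z[[x_1,x_2,\dots]]$. The noncommutative super Cauchy product is $$\Omega(\mathbf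 x,\mathbf u)=\prod_{j=1}^{\infty}\bigl(c_{z_1}(x_j)\cdots c_{z_{2N}}(x_j)\bigr),$$ where the $x_j$ commute with everything, $z_1\lessdot\cdots\lessdot z_{2N}$ are the letters, $c_z(x)=(1-u_zx)^{-1}$ for $z$ unbarred and $c_z(x)=1+u_zx$ for $z$ barred. Write $m_\nu$ and $s_\nu$ for the monomial symmetric functions and the Schur functions, and $h_\alpha(\mathbf u)=h_{\alpha_1}(\mathbf u)h_{\alpha_2}(\mathbf u)\cdots$. Let $I_{\mathrm{kron}}$ be the two-sided ideal of $\mathcal U$ given by the following relations, where $x,y,z\in\mathcal A$ and the order is the natural one: $yyx=yxy$ for $y$ unbarred, $x<y$; $zyy=yzy$ for $y$ unbarred, $y<z$; $yyz=yzy$ for $y$ barred, $y<z$; $xyy=yxy$ for $y$ barred, $x<y$; $(xz-zx)y=y(xz-zx)$ for $x=y\!\downarrow=z\!\downarrow\downarrow$; and $xz=zx$ for $x<z\!\downarrow\downarrow$. **Theorem.** (a) Take the natural order. The $e_k(\mathbf u)$ commute in $\mathcal U/I_{\mathrm{kron}}$, and for every $\gamma\in(I_{\mathrm{kron}})^\perp$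 the series $F^<_\gamma(\mathbf x)$ is symmetric and $$F^<_\gamma(\mathbf x)=\sum_\nu s_\nu(\mathbf x)\,\langle\mathfrak J_\nu(\mathbf u),\gamma\rangle .$$ (b) Let $\lessdot$ be any shuffle order. The product $\Omega(\mathbf x,\mathbf u)$ converges coefficientwise, and in $\mathcal U$ $$\Omega(\mathbf x,\mathbf u)=\sum_{w}Q_{\mathrm{Des}(w)}(\mathbf x)\,w=\sum_{\alpha}\mathbf x^\alpha h_\alpha(\mathbf u),$$ over all colored words $w$ and all weak compositions $\alpha$. Hence $F^\lessdot_\gamma(\mathbf x)=\langle\Omega(\mathbf x,\mathbf u),\gamma\rangle$ for all $\gamma\in\mathcal U$. (c) Let $\lessdot$ be any shuffle order and $I$ any two-sided ideal of $\mathcal U$. The $e_k(\mathbf u)$ commute with each other in $\mathcal U/I$ if and only if the $h_k(\mathbf u)$ do. In that case $$\Omega(\mathbf x,\mathbf u)=\sum_\nu m_\nu(\mathbf x)h_\nu(\mathbf u)=\sum_\nu s_\nu(\mathbf x)\mathfrak J_\nu(\mathbf u)\quad\text{in }\mathcal U/I,$$ and for every $\gamma\in I^\perp$ the series $F^\lessdot_\gamma(\mathbf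 x)$ is symmetric and $F^\lessdot_\gamma(\mathbf x)=\sum_\nu s_\nu(\mathbf x)\,\langle\mathfrak J_\nu(\mathbf u),\gamma\rangle$. All sums over $\nu$ are over all partitions. -/

import Mathlib

namespace SuperSchur

/-- A family `f` of formal power series in `x_0, x_1, …` (over a possibly noncommutative ring)
has the formal sum `F`: every monomial occurs in only finitely many members of the family, and
its coefficients there add up to its coefficient in `F`. -/
def HasFormalSum {ι R : Type*} [Semiring R] (f : ι → MvPowerSeries ℕ R)
    (F : MvPowerSeries ℕ R) : Prop :=
  ∀ m : ℕ →₀ ℕ, (Function.support fun i => MvPowerSeries.coeff m (f i)).Finite ∧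
    ∑ᶠ i, MvPowerSeries.coeff m (f i) = MvPowerSeries.coeff m F

/-- `F` is invariant under all permutations of the variables. -/
def IsSymmetricSeries (F : MvPowerSeries ℕ ℤ) : Prop :=
  ∀ σ : Equiv.Perm ℕ, MvPowerSeries.renameEquiv ℤ σ F = F

/-! ### Ordinary symmetric and quasisymmetric functions -/

/-- The content of a tableau: the exponent vector of `x^T`. -/
noncomputable def content {ν : YoungDiagram} (T : SemistandardYoungTableau ν) : ℕ →₀ ℕ :=
  ∑ c ∈ ν.cells, Finsupp.single (T c.1 c.2) 1

/-- The Schur function `s_ν(x) = ∑_T x^T`, the sum over semistandard tableaux of shape `ν`. -/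
noncomputable def schur (ν : YoungDiagram) : MvPowerSeries ℕ ℤ :=
  fun m => (Set.ncard {T : SemistandardYoungTableau ν | content T = m} : ℤ)

open scoped Classical in
/-- The monomial symmetric function `m_ν(x)`, the sum of all distinct monomials whose nonzero
exponents are, up to order, the parts of `ν`. -/
noncomputable def monomialSym (ν : YoungDiagram) : MvPowerSeries ℕ ℤ :=
  fun m => if m.support.val.map m = (ν.rowLens : Multiset ℕ) then 1 else 0

/-- The fundamental quasisymmetric function of degree `t` and descent set `D`: the sum of
`x_{i_0} ⋯ x_{i_{t-1}}` over `i_0 ≤ ⋯ ≤ i_{t-1}` with `i_j < i_{j+1}` whenever `j ∈ D`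
(positions are counted from `0`). -/
noncomputable def fundamentalQSym (t : ℕ) (D : Set ℕ) : MvPowerSeries ℕ ℤ :=
  fun m => (Set.ncard {i : Fin t → ℕ | Monotone i ∧
    (∀ (j : ℕ) (hj : j + 1 < t), j ∈ D → i ⟨j, by omega⟩ < i ⟨j + 1, hj⟩) ∧
    ∑ j, Finsupp.single (i j) 1 = m} : ℤ)

/-! ### Colored words and the free algebra -/

/-- The alphabet: `Sum.inl a` is the unbarred letter `a`, `Sum.inr a` the barred letter `a`. -/
def Letter (N : ℕ) : Type := Fin N ⊕ Fin N

instance (N : ℕ) : Fintype (Letter N) := inferInstanceAs (Fintype (Fin N ⊕ Fin N))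

/-- The unbarred letter `a`. -/
def plain {N : ℕ} (a : Fin N) : Letter N := Sum.inl a

/-- The barred letter `a`. -/
def barred {N : ℕ} (a : Fin N) : Letter N := Sum.inr a

/-- The letter is barred. -/
def IsBarred {N : ℕ} (z : Letter N) : Prop := ∃ a, z = barred a

/-- The letter is unbarred. -/
def IsPlain {N : ℕ} (z : Letter N) : Prop := ∃ a, z = plain a

/-- A shuffle order: a total order on the letters in which the unbarred letters and the barred
letters appear in their usual orders. -/
structure ShuffleOrder (N : ℕ) extends LinearOrder (Letter N) where
  plain_lt : ∀ a b : Fin N, a < b → lt (plain a) (plain b)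
  barred_lt : ∀ a b : Fin N, a < b → lt (barred a) (barred b)

/-- The position of a letter in the natural order (counted from `0`). -/
def naturalRank {N : ℕ} : Letter N → ℕ
  | Sum.inl a => 2 * a
  | Sum.inr a => 2 * a + 1

theorem naturalRank_injective {N : ℕ} : Function.Injective (naturalRank (N := N)) := by
  rintro (a | a) (b | b) h <;> simp only [naturalRank] at h
  · exact congrArg Sum.inl (Fin.ext (by omega))
  · omega
  · omega
  · exact congrArg Sum.inr (Fin.ext (by omega))

/-- The natural order `1 < 1̄ < 2 < 2̄ < ⋯ < N < N̄`. -/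
noncomputable def naturalOrder (N : ℕ) : ShuffleOrder N where
  toLinearOrder := LinearOrder.lift' naturalRank naturalRank_injective
  plain_lt a b h := by
    change naturalRank (plain a) < naturalRank (plain b)
    have : (a : ℕ) < b := h
    simp only [naturalRank, plain]; omega
  barred_lt a b h := by
    change naturalRank (barred a) < naturalRank (barred b)
    have : (a : ℕ) < b := h
    simp only [naturalRank, barred]; omega

/-- `y` is obtained from `x` by going down by one in the natural order:
`x = a + 1` and `y = ā`, or `x = ā` and `y = a`. -/
def IsDown {N : ℕ} (x y : Letter N) : Prop :=
  (∃ a b : Fin N, (b : ℕ) = a + 1 ∧ x = plain b ∧ y = barred a) ∨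
    ∃ a : Fin N, x = barred a ∧ y = plain a

/-- The free associative `ℤ`-algebra `𝒰` on the letters; its `ℤ`-basis of monomials is the set
of colored words. -/
abbrev FreeAlg (N : ℕ) : Type := MonoidAlgebra ℤ (FreeMonoid (Letter N))

/-- The monomial of a colored word. -/
noncomputable def word {N : ℕ} (w : List (Letter N)) : FreeAlg N :=
  MonoidAlgebra.of ℤ (FreeMonoid (Letter N)) (FreeMonoid.ofList w)

/-- The symmetric bilinear form on `𝒰` for which the colored words are orthonormal. -/
noncomputable def pairing {N : ℕ} (f g : FreeAlg N) : ℤ :=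
  f.coeff.sum fun w a => a * g.coeff w

/-- The orthogonal complement `I^⊥`. -/
def perp {N : ℕ} (I : Ideal (FreeAlg N)) : Set (FreeAlg N) :=
  {γ | ∀ f ∈ I, pairing f γ = 0}

/-- The generators of the ideal `I_kron`, in terms of the natural order. -/
inductive KronRel (N : ℕ) : FreeAlg N → Prop
  | yyx (x y : Letter N) : IsPlain y → (naturalOrder N).lt x y →
      KronRel N (word [y, y, x] - word [y, x, y])
  | zyy (z y : Letter N) : IsPlain y → (naturalOrder N).lt y z →
      KronRel N (word [z, y, y] - word [y, z, y])
  | yyz (z y : Letter N) : IsBarred y → (naturalOrder N).lt y z →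
      KronRel N (word [y, y, z] - word [y, z, y])
  | xyy (x y : Letter N) : IsBarred y → (naturalOrder N).lt x y →
      KronRel N (word [x, y, y] - word [y, x, y])
  | rotate (x y z : Letter N) : IsDown y x → IsDown z y →
      KronRel N ((word [x, z] - word [z, x]) * word [y]
        - word [y] * (word [x, z] - word [z, x]))
  | far (x z z' z'' : Letter N) : IsDown z z' → IsDown z' z'' → (naturalOrder N).lt x z'' →
      KronRel N (word [x, z] - word [z, x])

/-- The two-sided ideal `I_kron`. -/
noncomputable def kronIdeal (N : ℕ) : Ideal (FreeAlg N) :=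
  (TwoSidedIdeal.span {f | KronRel N f}).asIdeal

instance (N : ℕ) : (kronIdeal N).IsTwoSided :=
  inferInstanceAs (TwoSidedIdeal.span {f | KronRel N f}).asIdeal.IsTwoSided

/-! ### Noncommutative super symmetric functions -/

section

variable {N : ℕ} (o : ShuffleOrder N)

open scoped Classical in
/-- `e_k(u)`: the sum of the words `z_1 ⋯ z_k` in which each `z_i` is greater than `z_{i+1}`, or
the two are equal barred letters. -/
noncomputable def elem (k : ℕ) : FreeAlg N :=
  ∑ z : Fin k → Letter N,
    if (List.ofFn z).IsChain (fun y x => o.lt x y ∨ (y = x ∧ IsBarred y))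
    then word (List.ofFn z) else 0

/-- `e_k(u)` for an integer `k`; it vanishes for `k < 0`. -/
noncomputable def elemInt (k : ℤ) : FreeAlg N := if k < 0 then 0 else elem o k.toNat

open scoped Classical in
/-- `h_k(u)`: the sum of the words `z_1 ⋯ z_k` in which each `z_i` is less than `z_{i+1}`, or
the two are equal unbarred letters. -/
noncomputable def hom (k : ℕ) : FreeAlg N :=
  ∑ z : Fin k → Letter N,
    if (List.ofFn z).IsChain (fun y x => o.lt y x ∨ (y = x ∧ IsPlain y))
    then word (List.ofFn z) else 0

/-- `h_ν(u) = h_{ν_1}(u) h_{ν_2}(u) ⋯` for a partition `ν`. -/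
noncomputable def homPartition (ν : YoungDiagram) : FreeAlg N := (ν.rowLens.map (hom o)).prod

/-- All elements of the support of `m` are smaller than `bound m`. -/
def bound (m : ℕ →₀ ℕ) : ℕ := m.support.sup id + 1

/-- `h_α(u) = h_{α_0}(u) h_{α_1}(u) ⋯` for a weak composition `α`; the factors beyond the support
of `α` are `h_0(u) = 1` and are omitted. -/
noncomputable def homComposition (α : ℕ →₀ ℕ) : FreeAlg N :=
  ((List.range (bound α)).map fun j => hom o (α j)).prod

/-- The noncommutative super Schur function
`J_ν(u) = ∑_π sgn(π) e_{ν'_1+π(1)-1}(u) ⋯ e_{ν'_t+π(t)-t}(u)`, where `t = ν_1`. -/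
noncomputable def superSchur (ν : YoungDiagram) : FreeAlg N :=
  ∑ π : Equiv.Perm (Fin (ν.rowLen 0)), ((Equiv.Perm.sign π : ℤˣ) : ℤ) •
    (List.ofFn fun i : Fin (ν.rowLen 0) =>
      elemInt o ((ν.colLen i : ℤ) + ((π i : ℕ) : ℤ) - ((i : ℕ) : ℤ))).prod

/-- The `e_k(u)` commute in `𝒰/I`. -/
def ElemCommute (I : Ideal (FreeAlg N)) [I.IsTwoSided] : Prop :=
  ∀ k l : ℕ, Commute (Ideal.Quotient.mk I (elem o k)) (Ideal.Quotient.mk I (elem o l))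

/-- The `h_k(u)` commute in `𝒰/I`. -/
def HomCommute (I : Ideal (FreeAlg N)) [I.IsTwoSided] : Prop :=
  ∀ k l : ℕ, Commute (Ideal.Quotient.mk I (hom o k)) (Ideal.Quotient.mk I (hom o l))

/-- The descent set of a colored word (positions are counted from `0`). -/
def descents (w : List (Letter N)) : Set ℕ :=
  {j | ∃ h : j + 1 < w.length, o.lt w[j + 1] w[j] ∨ (w[j] = w[j + 1] ∧ IsBarred w[j])}

/-- `Q_{Des(w)}(x)`. -/
noncomputable def wordQSym (w : List (Letter N)) : MvPowerSeries ℕ ℤ :=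
  fundamentalQSym w.length (descents o w)

/-- `F_γ(x) = ∑_w γ_w Q_{Des(w)}(x)`. -/
noncomputable def F (γ : FreeAlg N) : MvPowerSeries ℕ ℤ :=
  γ.coeff.sum fun w a => a • wordQSym o w.toList

open scoped Classical in
/-- The factor `c_z(x_j)` of the Cauchy product: `(1 - u_z x_j)⁻¹` for an unbarred letter `z`, and
`1 + u_z x_j` for a barred letter `z`. The variables `x_j` commute with everything. -/
noncomputable def cauchyFactor (z : Letter N) (j : ℕ) : MvPowerSeries ℕ (FreeAlg N) :=
  if IsBarred z then 1 + MvPowerSeries.C (word [z]) * MvPowerSeries.X j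
  else MvPowerSeries.invOfUnit (1 - MvPowerSeries.C (word [z]) * MvPowerSeries.X j) 1

/-- The product of the first `n` blocks `c_{z_1}(x_j) ⋯ c_{z_{2N}}(x_j)` of the Cauchy product,
where `z_1, …, z_{2N}` are the letters in increasing order. -/
noncomputable def cauchyPartial (n : ℕ) : MvPowerSeries ℕ (FreeAlg N) :=
  letI := o.toLinearOrder
  ((List.range n).map fun j =>
    (((Finset.univ : Finset (Letter N)).sort (· ≤ ·)).map fun z => cauchyFactor z j).prod).prod

/-- The noncommutative super Cauchy product `Ω(x, u)`, the infinite product of all blocks: the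
blocks beyond the variables of a monomial do not contribute to its coefficient. -/
noncomputable def cauchy : MvPowerSeries ℕ (FreeAlg N) :=
  fun m => MvPowerSeries.coeff m (cauchyPartial o (bound m))

end

/-- The series `f(x) a` with coefficients in `A`, for an integral series `f` and `a ∈ A`. -/
noncomputable def seriesMul {A : Type*} [Ring A] (f : MvPowerSeries ℕ ℤ) (a : A) :
    MvPowerSeries ℕ A :=
  fun m => MvPowerSeries.coeff m f • a

end SuperSchur

/-!
The generating function `∑ h_k X^k` is the product over the letters, in increasing order, of
`(1 - u_z X)⁻¹` for `z` unbarred and `1 + u_z X` for `z` barred, and its inverse is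
`∑ (-1)^k e_k X^k`; hence modulo an ideal the `h_k` commute if and only if the `e_k` do.

For `I_kron` the `e_k` commute because the generating functions at two central variables commute.
This is an induction on the number of letters: the relations let a new largest factor be moved past
the products over the smaller letters, at the cost of commutators that commute with the letters in
between.

The coefficient of `x^m` in the Cauchy product is `h_{m_0} h_{m_1} ⋯`, and expanding each `h_k` into
words sorts the colored words by their descent sets. If the `e_k` commute modulo `I`, this
coefficient and all `𝔍_ν` are images of elements of a commutative ring, where `h_k 𝔍_μ` is the sum
of the `𝔍_ν` with `ν / μ` a horizontal strip of size `k` (Pieri's rule). Removing the largest entry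
of a tableau matches this with the recursion for Kostka numbers, so that
`h_{m_0} h_{m_1} ⋯ = ∑ K_{ν m} 𝔍_ν`. The symmetry and the expansion of `F_γ` follow by pairing
with `γ`.
-/

namespace SuperSchur

open scoped PowerSeries

/-! ### Generating functions of words -/

section WordSum

variable {ι A B : Type*} [Fintype ι] [Ring A] [Ring B]

open scoped Classical in
/-- The sum of the monomials `u z_1 ⋯ u z_k` over the words `z_1 ⋯ z_k` with the property `P`,
where the letters take values in an arbitrary ring. -/
noncomputable def wordSum (u : ι → A) (P : List ι → Prop) (k : ℕ) : A :=
  ∑ z : Fin k → ι, if P (List.ofFn z) then ((List.ofFn z).map u).prod else 0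

variable (u : ι → A) {P Q : List ι → Prop} {k : ℕ}

theorem wordSum_congr (h : ∀ w, w.length = k → (P w ↔ Q w)) : wordSum u P k = wordSum u Q k :=
  Finset.sum_congr rfl fun z _ => by
    by_cases hP : P (List.ofFn z)
    · rw [if_pos hP, if_pos ((h _ List.length_ofFn).1 hP)]
    · rw [if_neg hP, if_neg (mt (h _ List.length_ofFn).2 hP)]

theorem wordSum_eq_zero (h : ∀ w, w.length = k → ¬P w) : wordSum u P k = 0 :=
  Finset.sum_eq_zero fun _ _ => if_neg (h _ List.length_ofFn)

theorem wordSum_zero (h : P []) : wordSum u P 0 = 1 := by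
  simp [wordSum, h]

theorem wordSum_or (h : ∀ w, P w → ¬Q w) :
    wordSum u (fun w => P w ∨ Q w) k = wordSum u P k + wordSum u Q k := by
  rw [wordSum, wordSum, wordSum, ← Finset.sum_add_distrib]
  refine Finset.sum_congr rfl fun z _ => ?_
  by_cases hP : P (List.ofFn z)
  · rw [if_pos (Or.inl hP), if_pos hP, if_neg (h _ hP), add_zero]
  · by_cases hQ : Q (List.ofFn z)
    · rw [if_pos (Or.inr hQ), if_neg hP, if_pos hQ, zero_add]
    · rw [if_neg (not_or.2 ⟨hP, hQ⟩), if_neg hP, if_neg hQ, zero_add]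

theorem wordSum_mul_wordSum (k l : ℕ) :
    wordSum u P k * wordSum u Q l =
      wordSum u (fun w => P (w.take k) ∧ Q (w.drop k)) (k + l) := by
  rw [wordSum, wordSum, wordSum, Fintype.sum_mul_sum, ← Fintype.sum_prod_type']
  refine Fintype.sum_equiv (Fin.appendEquiv k l) _ _ fun z => ?_
  have hz : List.ofFn (Fin.appendEquiv k l z) = List.ofFn z.1 ++ List.ofFn z.2 :=
    List.ofFn_fin_append z.1 z.2
  rw [hz, List.take_left' List.length_ofFn, List.drop_left' List.length_ofFn, List.map_append,
    List.prod_append, ite_zero_mul_ite_zero]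
  split_ifs <;> rfl

theorem mul_wordSum (z : ι) :
    u z * wordSum u P k = wordSum u (fun w => w.head? = some z ∧ P w.tail) (k + 1) := by
  classical
  rw [wordSum, wordSum, ← (Fin.consEquiv fun _ => ι).sum_comp, Fintype.sum_prod_type,
    Fintype.sum_eq_single z fun y hy => ?_, Finset.mul_sum]
  · simp [List.ofFn_succ]
  · simp [List.ofFn_succ, hy]

theorem map_wordSum (φ : A →+* B) : φ (wordSum u P k) = wordSum (fun z => φ (u z)) P k := by
  simp only [wordSum, map_sum, apply_ite φ, map_zero, map_list_prod, List.map_map,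
    Function.comp_def]

theorem wordSum_neg : wordSum (fun z => -u z) P k = (-1) ^ k * wordSum u P k := by
  have hneg (w : List ι) : (w.map fun z => -u z).prod = (-1) ^ w.length * (w.map u).prod := by
    simpa [Function.comp_def] using (w.map u).prod_map_neg
  simp only [wordSum, hneg, List.length_ofFn, Finset.mul_sum, mul_ite, mul_zero]

end WordSum

section Chains

variable {ι A : Type*} [Ring A]

/-- Two consecutive letters in a chain are related by `r`, or equal and repeatable. -/
def Step (r : ι → ι → Prop) (p : ι → Prop) (a b : ι) : Prop := r a b ∨ (a = b ∧ p a)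

instance (r : ι → ι → Prop) [IsTrans ι r] (p : ι → Prop) : IsTrans ι (Step r p) where
  trans _ _ _ := by
    rintro (h | ⟨rfl, h⟩) (h' | ⟨rfl, -⟩)
    exacts [Or.inl (_root_.trans h h'), Or.inl h, Or.inl h', Or.inr ⟨rfl, h⟩]

/-- The word `w` is a chain for `Step r p` with all letters in the list `L`. -/
def IsChainIn (r : ι → ι → Prop) (p : ι → Prop) (L w : List ι) : Prop :=
  w.IsChain (Step r p) ∧ w ⊆ L

theorem isChainIn_nil (r : ι → ι → Prop) (p : ι → Prop) (L : List ι) : IsChainIn r p L [] :=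
  ⟨List.isChain_nil, List.nil_subset L⟩

variable {r : ι → ι → Prop} {p : ι → Prop} {z : ι} {L : List ι}

theorem isChainIn_cons_cons_self [IsStrictOrder ι r] (hz : ∀ y ∈ L, r z y)
    [Decidable (p z)] {w : List ι} :
    IsChainIn r p (z :: L) (z :: w) ↔ IsChainIn r p (if p z then z :: L else L) w := by
  have hzL : z ∉ L := fun h => irrefl z (hz z h)
  have hstep (y : ι) (hy : y ∈ z :: L) : Step r p z y ↔ y ∈ if p z then z :: L else L := by
    obtain rfl | hy := List.mem_cons.1 hy
    · by_cases hp : p y <;> simp [Step, hp, hzL, irrefl y]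
    · by_cases hp : p z <;> simp [Step, hz y hy, hy, hp]
  have hsub : (if p z then z :: L else L) ⊆ z :: L := by split_ifs <;> simp
  simp only [IsChainIn, List.isChain_iff_pairwise, List.pairwise_cons, List.cons_subset,
    List.mem_cons_self, true_and]
  constructor
  · rintro ⟨⟨hw, hchain⟩, hwL⟩
    exact ⟨hchain, fun y hy => (hstep y (hwL hy)).1 (hw y hy)⟩
  · rintro ⟨hchain, hw⟩
    exact ⟨⟨fun y hy => (hstep y (hsub (hw hy))).2 (hw hy), hchain⟩, List.Subset.trans hw hsub⟩

theorem isChainIn_cons_iff_of_head?_ne [IsStrictOrder ι r] (hz : ∀ y ∈ L, r z y) {w : List ι}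
    (hw : w.head? ≠ some z) : IsChainIn r p (z :: L) w ↔ IsChainIn r p L w := by
  refine ⟨fun ⟨hchain, hwL⟩ => ⟨hchain, ?_⟩, fun ⟨hchain, hwL⟩ =>
    ⟨hchain, List.subset_cons_of_subset z hwL⟩⟩
  cases w with
  | nil => exact List.nil_subset L
  | cons a w =>
    have haz : a ≠ z := fun h => hw (congrArg some h)
    have ha : a ∈ L := (List.mem_cons.1 (hwL List.mem_cons_self)).resolve_left haz
    refine fun y hy => (List.mem_cons.1 (hwL hy)).resolve_left ?_
    rintro rfl
    obtain hy | hy := List.mem_cons.1 hy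
    · exact haz hy.symm
    · obtain h | ⟨h, -⟩ := (List.pairwise_cons.1 (List.isChain_iff_pairwise.1 hchain)).1 y hy
      · exact irrefl a (_root_.trans h (hz a ha))
      · exact haz h

theorem isChainIn_cons_iff [IsStrictOrder ι r] [Decidable (p z)] (hL : (z :: L).Pairwise r)
    {w : List ι} :
    IsChainIn r p (z :: L) w ↔ IsChainIn r p L w ∨
      (w.head? = some z ∧ IsChainIn r p (if p z then z :: L else L) w.tail) := by
  have hz := (List.pairwise_cons.1 hL).1
  have hzL : z ∉ L := fun h => irrefl z (hz z h)
  by_cases hw : w.head? = some z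
  · obtain ⟨w, rfl⟩ := List.head?_eq_some_iff.1 hw
    rw [isChainIn_cons_cons_self hz]
    simp [IsChainIn, hzL]
  · simp [isChainIn_cons_iff_of_head?_ne hz hw, hw]

/-- The invertible power series `1 + a X`. -/
noncomputable def oneAddMulX (a : A) : A⟦X⟧ˣ where
  val := 1 + PowerSeries.C a * PowerSeries.X
  inv := PowerSeries.invOfUnit (1 + PowerSeries.C a * PowerSeries.X) 1
  val_inv := PowerSeries.mul_invOfUnit _ _ (by simp)
  inv_val := PowerSeries.invOfUnit_mul _ _ (by simp)

open scoped Classical in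
/-- The generating function of the powers of a letter of value `a`: `(1 - a X)⁻¹` if the letter is
repeatable and `1 + a X` if it is not. -/
noncomputable def factor (p : Prop) (a : A) : A⟦X⟧ˣ :=
  if p then (oneAddMulX (-a))⁻¹ else oneAddMulX a

theorem inv_factor (p : Prop) (a : A) : (factor p a)⁻¹ = factor (¬p) (-a) := by
  by_cases h : p <;> simp [factor, h]

variable [Fintype ι] (u : ι → A)

/-- The generating function, by length, of the chains with letters in `L`. -/
noncomputable def chainSeries (r : ι → ι → Prop) (p : ι → Prop) (L : List ι) : A⟦X⟧ :=
  PowerSeries.mk (wordSum u (IsChainIn r p L))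

theorem chainSeries_nil : chainSeries u r p [] = 1 := by
  ext k
  rw [chainSeries, PowerSeries.coeff_mk, PowerSeries.coeff_one]
  split_ifs with hk
  · rw [hk, wordSum_zero u (isChainIn_nil r p [])]
  · refine wordSum_eq_zero u fun w hw h => hk ?_
    rw [← hw, List.subset_nil.1 h.2, List.length_nil]

open scoped Classical in
theorem chainSeries_cons [IsStrictOrder ι r] (hL : (z :: L).Pairwise r) :
    chainSeries u r p (z :: L) = chainSeries u r p L +
      PowerSeries.C (u z) * PowerSeries.X * chainSeries u r p (if p z then z :: L else L) := by
  ext k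
  rw [map_add, mul_assoc, PowerSeries.coeff_C_mul]
  simp only [chainSeries, PowerSeries.coeff_mk]
  cases k with
  | zero => simp [wordSum_zero u (isChainIn_nil _ _ _)]
  | succ k =>
    rw [PowerSeries.coeff_succ_X_mul, PowerSeries.coeff_mk, mul_wordSum, ← wordSum_or]
    · exact wordSum_congr u fun w _ => isChainIn_cons_iff hL
    · rintro w ⟨-, hw⟩ ⟨hz, -⟩
      exact irrefl z ((List.pairwise_cons.1 hL).1 z (hw (List.mem_of_head? hz)))

theorem chainSeries_eq_prod [IsStrictOrder ι r] (hL : L.Pairwise r) :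
    chainSeries u r p L = ↑(L.map fun z => factor (p z) (u z)).prod := by
  induction L with
  | nil => rw [chainSeries_nil, List.map_nil, List.prod_nil, Units.val_one]
  | cons z L ih =>
    have hcons := chainSeries_cons u (p := p) hL
    rw [List.map_cons, List.prod_cons, Units.val_mul, ← ih hL.of_cons]
    by_cases hp : p z
    · rw [factor, if_pos hp, ← Units.inv_mul_eq_iff_eq_mul, inv_inv]
      rw [if_pos hp] at hcons
      rw [oneAddMulX, Units.val_mk, map_neg, neg_mul, ← sub_eq_add_neg, sub_mul, one_mul]
      exact sub_eq_iff_eq_add.2 hcons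
    · rw [hcons, if_neg hp, factor, if_neg hp, oneAddMulX, add_mul, one_mul]

end Chains

section GeneratingFunctions

variable {A : Type*} [Ring A]

theorem commute_C_iff {a : A} {F : A⟦X⟧} :
    Commute (PowerSeries.C a) F ↔ ∀ k, Commute a (PowerSeries.coeff k F) := by
  simp only [Commute, SemiconjBy, PowerSeries.ext_iff, PowerSeries.coeff_C_mul,
    PowerSeries.coeff_mul_C]

theorem commute_coeff_iff_inv (H : A⟦X⟧ˣ) :
    (∀ k l, Commute (PowerSeries.coeff k (H : A⟦X⟧)) (PowerSeries.coeff l (H : A⟦X⟧))) ↔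
      ∀ k l, Commute (PowerSeries.coeff k (↑H⁻¹ : A⟦X⟧)) (PowerSeries.coeff l (↑H⁻¹ : A⟦X⟧)) := by
  suffices h : ∀ H : A⟦X⟧ˣ,
      (∀ k l, Commute (PowerSeries.coeff k (H : A⟦X⟧)) (PowerSeries.coeff l (H : A⟦X⟧))) →
      ∀ k l, Commute (PowerSeries.coeff k (↑H⁻¹ : A⟦X⟧)) (PowerSeries.coeff l (↑H⁻¹ : A⟦X⟧)) from
    ⟨h H, fun h' => by simpa only [inv_inv] using h H⁻¹ h'⟩
  intro H hH
  have commute_inv {a : A} (ha : ∀ k, Commute a (PowerSeries.coeff k (H : A⟦X⟧))) (k : ℕ) :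
      Commute a (PowerSeries.coeff k (↑H⁻¹ : A⟦X⟧)) :=
    commute_C_iff.1 (commute_C_iff.2 ha).units_inv_right k
  exact fun k => commute_inv fun l => (commute_inv (hH l) k).symm

theorem isPlain_iff_not_isBarred {N : ℕ} {z : Letter N} : IsPlain z ↔ ¬IsBarred z := by
  obtain a | a := z
  · exact ⟨fun _ ⟨b, hb⟩ => Sum.inl_ne_inr hb, fun _ => ⟨a, rfl⟩⟩
  · exact ⟨fun ⟨b, hb⟩ => absurd hb Sum.inr_ne_inl, fun h => (h ⟨a, rfl⟩).elim⟩

theorem isBarred_iff_not_isPlain {N : ℕ} {z : Letter N} : IsBarred z ↔ ¬IsPlain z := by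
  rw [isPlain_iff_not_isBarred, not_not]

theorem word_append {N : ℕ} (v w : List (Letter N)) : word (v ++ w) = word v * word w := by
  rw [word, FreeMonoid.ofList_append, map_mul, word, word]

theorem prod_map_word {N : ℕ} (w : List (Letter N)) : (w.map fun z => word [z]).prod = word w := by
  induction w with
  | nil => exact (map_one _).symm
  | cons z w ih => rw [List.map_cons, List.prod_cons, ih, ← word_append, List.singleton_append]

variable {N : ℕ} (o : ShuffleOrder N)

instance : IsStrictOrder (Letter N) fun a b => o.lt a b :=
  letI := o.toLinearOrder
  inferInstanceAs (IsStrictOrder (Letter N) (· < ·))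

instance : IsStrictOrder (Letter N) fun a b => o.lt b a :=
  letI := o.toLinearOrder
  inferInstanceAs (IsStrictOrder (Letter N) (· > ·))

/-- The letters in increasing order. -/
noncomputable def letters : List (Letter N) :=
  letI := o.toLinearOrder
  (Finset.univ : Finset (Letter N)).sort (· ≤ ·)

theorem mem_letters (z : Letter N) : z ∈ letters o :=
  letI := o.toLinearOrder
  (Finset.mem_sort _).2 (Finset.mem_univ z)

theorem pairwise_letters : (letters o).Pairwise fun a b => o.lt a b :=
  letI := o.toLinearOrder
  (Finset.sortedLT_sort _).pairwise

theorem elem_eq_wordSum (k : ℕ) :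
    elem o k = wordSum (fun z => word [z])
      (List.IsChain (Step (fun a b => o.lt b a) IsBarred)) k := by
  simp only [wordSum, prod_map_word]
  exact Finset.sum_congr rfl fun _ _ => by congr

theorem hom_eq_wordSum (k : ℕ) :
    hom o k = wordSum (fun z => word [z])
      (List.IsChain (Step (fun a b => o.lt a b) IsPlain)) k := by
  simp only [wordSum, prod_map_word]
  exact Finset.sum_congr rfl fun _ _ => by congr

theorem chainSeries_eq_mk {ι : Type*} [Fintype ι] (u : ι → A) (r : ι → ι → Prop) (p : ι → Prop)
    {L : List ι} (hL : ∀ z, z ∈ L) :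
    chainSeries u r p L = PowerSeries.mk (wordSum u (List.IsChain (Step r p))) :=
  congrArg PowerSeries.mk <| funext fun _ =>
    wordSum_congr u fun _ _ => and_iff_left fun z _ => hL z

/-- The generating function `∑ h_k(u) X^k` of the `h_k(u)`, as a product over the letters. -/
noncomputable def homSeries : (FreeAlg N)⟦X⟧ˣ :=
  ((letters o).map fun z => factor (IsPlain z) (word [z])).prod

theorem mk_hom : PowerSeries.mk (hom o) = homSeries o := by
  rw [homSeries, ← chainSeries_eq_prod _ (pairwise_letters o),
    chainSeries_eq_mk _ _ _ (mem_letters o)]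
  exact congrArg PowerSeries.mk (funext (hom_eq_wordSum o))

theorem mk_map_elem {B : Type*} [Ring B] (φ : FreeAlg N →+* B) :
    PowerSeries.mk (fun k => φ (elem o k)) =
      ↑((letters o).reverse.map fun z => factor (IsBarred z) (φ (word [z]))).prod := by
  rw [← chainSeries_eq_prod _ (List.pairwise_reverse.2 (pairwise_letters o)),
    chainSeries_eq_mk _ _ _ fun z => List.mem_reverse.2 (mem_letters o z)]
  simp only [elem_eq_wordSum, map_wordSum]

theorem inv_homSeries : (↑(homSeries o)⁻¹ : (FreeAlg N)⟦X⟧) =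
    PowerSeries.mk fun k => (-1) ^ k * elem o k := by
  rw [homSeries, List.prod_inv_reverse, List.map_map, ← List.map_reverse]
  simp only [Function.comp_def, inv_factor, ← isBarred_iff_not_isPlain]
  rw [← chainSeries_eq_prod _ (List.pairwise_reverse.2 (pairwise_letters o)),
    chainSeries_eq_mk _ _ _ fun z => List.mem_reverse.2 (mem_letters o z)]
  simp only [elem_eq_wordSum, ← wordSum_neg]

theorem hom_zero : hom o 0 = 1 := by
  rw [hom_eq_wordSum, wordSum_zero _ List.isChain_nil]

theorem elem_zero : elem o 0 = 1 := by
  rw [elem_eq_wordSum, wordSum_zero _ List.isChain_nil]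

theorem elemCommute_iff_homCommute (I : Ideal (FreeAlg N)) [I.IsTwoSided] :
    ElemCommute o I ↔ HomCommute o I := by
  have h := commute_coeff_iff_inv
    (Units.map (PowerSeries.map (Ideal.Quotient.mk I)).toMonoidHom (homSeries o))
  rw [← map_inv] at h
  simp only [Units.coe_map, RingHom.toMonoidHom_eq_coe, MonoidHom.coe_coe, PowerSeries.coeff_map,
    inv_homSeries, ← mk_hom, PowerSeries.coeff_mk, map_mul, map_pow, map_neg, map_one] at h
  rw [HomCommute, h]
  refine forall₂_congr fun k l => ?_
  obtain hk | hk := neg_one_pow_eq_or (FreeAlg N ⧸ I) k <;>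
    obtain hl | hl := neg_one_pow_eq_or (FreeAlg N ⧸ I) l <;>
    simp only [hk, hl, one_mul, neg_one_mul, Commute.neg_left_iff, Commute.neg_right_iff]

end GeneratingFunctions

/-! ### The relations of `I_kron` -/

section Kron

variable {ι A B : Type*} [Ring A] [Ring B]

/-- The relations of the ideal `I_kron`, for the values `v` of the letters in an arbitrary ring, an
arbitrary relation `r` in place of the natural order, and an arbitrary set `b` of barred letters.
The last relation covers both kinds of relations between distant letters: either all three letters
are consecutive, or the outer two commute already. -/
structure KronRelations (r : ι → ι → Prop) (b : ι → Prop) (v : ι → A) : Prop where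
  upper_plain : ∀ i j, r i j → ¬b j → v j * ⁅v i, v j⁆ = 0
  upper_barred : ∀ i j, r i j → b j → ⁅v i, v j⁆ * v j = 0
  lower_plain : ∀ i j, r i j → ¬b i → ⁅v i, v j⁆ * v i = 0
  lower_barred : ∀ i j, r i j → b i → v i * ⁅v i, v j⁆ = 0
  middle : ∀ i j k, r i j → r j k → Commute (v j) ⁅v i, v k⁆

variable {r : ι → ι → Prop} {b : ι → Prop}

theorem KronRelations.map {v : ι → A} (hv : KronRelations r b v) (φ : A →+* B) :
    KronRelations r b fun i => φ (v i) := by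
  have hlie (i j : ι) : ⁅φ (v i), φ (v j)⁆ = φ ⁅v i, v j⁆ := by
    rw [Ring.lie_def, Ring.lie_def, map_sub, map_mul, map_mul]
  constructor <;> intros <;> simp only [hlie, ← map_mul]
  · rw [hv.upper_plain _ _ ‹_› ‹_›, map_zero]
  · rw [hv.upper_barred _ _ ‹_› ‹_›, map_zero]
  · rw [hv.lower_plain _ _ ‹_› ‹_›, map_zero]
  · rw [hv.lower_barred _ _ ‹_› ‹_›, map_zero]
  · exact (hv.middle _ _ _ ‹_› ‹_›).map φ

variable {R : Type*} [CommRing R] [Module R A] [IsScalarTower R A A] [SMulCommClass R A A]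

/-- The unit `Z` is the factor of a letter of value `y` at the scalar `s`: it is `1 + s y` for a
plain letter and `(1 - s y)⁻¹` for a barred one. -/
structure IsFactor (s : R) (b : Prop) (y : A) (Z : Aˣ) : Prop where
  plain : ¬b → (Z : A) = 1 + s • y
  barred : b → (↑Z⁻¹ : A) = 1 - s • y

theorem IsFactor.commute {s : R} {b : Prop} {y x : A} {Z : Aˣ} (hZ : IsFactor s b y Z)
    (h : Commute y x) : Commute (Z : A) x := by
  by_cases hb : b
  · rw [← inv_inv Z]
    exact Commute.units_inv_left (hZ.barred hb ▸ (Commute.one_left x).sub_left (h.smul_left s))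
  · exact hZ.plain hb ▸ (Commute.one_left x).add_left (h.smul_left s)

theorem IsFactor.semiconjBy {s : R} {b : Prop} {y z : A} {Z : Aˣ} (hZ : IsFactor s b y Z)
    (hplain : ¬b → ⁅y, z⁆ * y = 0) (hbarred : b → y * ⁅y, z⁆ = 0) :
    SemiconjBy (Z : A) z (z + s • ⁅y, z⁆) := by
  have hyz : y * z = z * y + ⁅y, z⁆ := by rw [Ring.lie_def, add_sub_cancel]
  by_cases hb : b
  · rw [← SemiconjBy.units_inv_symm_left_iff, hZ.barred hb, SemiconjBy]
    simp only [sub_mul, mul_sub, mul_add, one_mul, mul_one, smul_mul_assoc, mul_smul_comm,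
      hbarred hb, hyz, smul_zero, smul_add]
    module
  · rw [hZ.plain hb, SemiconjBy]
    simp only [add_mul, mul_add, one_mul, mul_one, smul_mul_assoc, mul_smul_comm,
      hplain hb, hyz, smul_zero, smul_add]
    module

variable {v : ι → A} {s t : R} {L : List ι} {z : ι} {Z W : ι → Aˣ}

theorem KronRelations.semiconjBy_prod (hv : KronRelations r b v)
    (hZ : ∀ i, IsFactor s (b i) (v i) (Z i)) (hL : L.Pairwise (flip r)) (hz : ∀ y ∈ L, r y z) :
    SemiconjBy (↑(L.map Z).prod : A) (v z) (v z + s • (L.map fun y => ⁅v y, v z⁆).sum) := by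
  induction L with
  | nil => simp
  | cons y L ih =>
    rw [List.forall_mem_cons] at hz
    rw [List.pairwise_cons] at hL
    have hcomm : Commute (Z y : A) (L.map fun x => ⁅v x, v z⁆).sum :=
      Commute.list_sum_right _ _ fun g hg => by
        obtain ⟨x, hx, rfl⟩ := List.mem_map.1 hg
        exact (hZ y).commute (hv.middle x y z (hL.1 x hx) hz.1)
    have hstep := ((hZ y).semiconjBy (hv.lower_plain y z hz.1) (hv.lower_barred y z hz.1)).add_right
      (hcomm.smul_right s)
    rw [List.map_cons, List.prod_cons, Units.val_mul, List.map_cons, List.sum_cons, smul_add,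
      ← add_assoc]
    exact hstep.mul_left (ih hL.2 hz.2)

theorem commute_one_add_smul_mul {y g P Q : A} (hPQ : Commute P Q)
    (hP : SemiconjBy P y (y + s • g)) (hQ : SemiconjBy Q y (y + t • g)) (hyg : y * g = 0) :
    Commute ((1 + s • y) * P) ((1 + t • y) * Q) := by
  have expand {s t : R} {P Q : A} (hP : SemiconjBy P y (y + s • g)) :
      ((1 + s • y) * P) * ((1 + t • y) * Q) =
        (1 + (s • y + t • y) + (s * t) • (g + y * y)) * (P * Q) := by
    have hP' : P * (1 + t • y) = (1 + t • (y + s • g)) * P :=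
      ((SemiconjBy.one_right P).add_right (hP.smul_right t)).eq
    rw [mul_assoc, ← mul_assoc P, hP', ← mul_assoc, ← mul_assoc, ← mul_assoc]
    congr 2
    simp only [add_mul, mul_add, mul_one, one_mul, smul_mul_assoc, mul_smul_comm, hyg, smul_zero,
      smul_add, smul_smul, mul_comm t s]
    module
  rw [Commute, SemiconjBy, expand hP, expand hQ, hPQ.eq, mul_comm t s, add_comm (t • y)]

open MulOpposite in
theorem IsFactor.commute_mul {b : Prop} {y g : A} {Z W P Q : Aˣ} (hZ : IsFactor s b y Z)
    (hW : IsFactor t b y W) (hPQ : Commute P Q) (hP : SemiconjBy (P : A) y (y + s • g))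
    (hQ : SemiconjBy (Q : A) y (y + t • g)) (hplain : ¬b → y * g = 0) (hbarred : b → g * y = 0) :
    Commute (Z * P) (W * Q) := by
  by_cases hb : b
  · -- the inverses are products as for a plain letter of value `-y`, in the opposite ring
    have hop {s : R} {P : Aˣ} (hP : SemiconjBy (P : A) y (y + s • g)) :
        SemiconjBy (op (↑P⁻¹ : A)) (op (-y)) (op (-y) + s • op (-g)) := by
      rw [← op_smul, ← op_add, smul_neg, ← neg_add]
      exact (hP.neg_right.units_inv_symm_left).op
    have := commute_one_add_smul_mul (s := s) (t := t)
      (hPQ.inv_inv.map (Units.coeHom A)).op (hop hP) (hop hQ)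
      (by rw [← op_mul, neg_mul_neg, hbarred hb, op_zero])
    refine Commute.inv_inv_iff.1 (Units.ext (op_injective ?_))
    simpa only [mul_inv_rev, Units.val_mul, hZ.barred hb, hW.barred hb, op_mul, op_sub, op_one,
      op_smul, op_neg, smul_neg, ← sub_eq_add_neg, Units.coeHom_apply] using this.eq.symm
  · refine Units.ext ?_
    simpa only [Units.val_mul, hZ.plain hb, hW.plain hb, Units.coeHom_apply] using
      (commute_one_add_smul_mul (hPQ.map (Units.coeHom A)) hP hQ (hplain hb)).eq

theorem KronRelations.commute_prod (hv : KronRelations r b v)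
    (hZ : ∀ i, IsFactor s (b i) (v i) (Z i)) (hW : ∀ i, IsFactor t (b i) (v i) (W i))
    (hL : L.Pairwise (flip r)) : Commute (L.map Z).prod (L.map W).prod := by
  induction L with
  | nil => exact Commute.one_left _
  | cons z L ih =>
    obtain ⟨hz, hL⟩ := List.pairwise_cons.1 hL
    rw [List.map_cons, List.prod_cons, List.map_cons, List.prod_cons]
    refine (hZ z).commute_mul (hW z) (ih hL) (hv.semiconjBy_prod hZ hL hz)
      (hv.semiconjBy_prod hW hL hz) (fun hb => ?_) (fun hb => ?_)
    · rw [← List.sum_map_mul_left, List.sum_eq_zero]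
      simpa using fun y hy => hv.upper_plain y z (hz y hy) hb
    · rw [← List.sum_map_mul_right, List.sum_eq_zero]
      simpa using fun y hy => hv.upper_barred y z (hz y hy) hb

end Kron

section KronSeries

variable {ι A S : Type*} [Ring A] [Ring S]

theorem isFactor_map_factor (φ : A⟦X⟧ →+* S) {s : Subring.center S} (hs : φ PowerSeries.X = s)
    (b : Prop) (a : A) :
    IsFactor s b (φ (PowerSeries.C a)) (Units.map φ.toMonoidHom (factor b a)) := by
  have hval : φ (PowerSeries.C a * PowerSeries.X) = s • φ (PowerSeries.C a) := by
    rw [map_mul, hs, Subring.smul_def, smul_eq_mul, (Subring.mem_center_iff.1 s.2 _)]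
  constructor <;> intro hb
  · rw [factor, if_neg hb, ← hval, ← map_one φ, ← map_add]
    rfl
  · rw [factor, if_pos hb, ← map_inv, inv_inv, ← hval, ← map_one φ, ← map_sub, sub_eq_add_neg,
      ← neg_mul, ← map_neg]
    rfl

theorem KronRelations.commute_coeff {r : ι → ι → Prop} {b : ι → Prop} {v : ι → A}
    (hv : KronRelations r b v) {L : List ι} (hL : L.Pairwise (flip r)) (k l : ℕ) :
    Commute (PowerSeries.coeff k (↑(L.map fun z => factor (b z) (v z)).prod : A⟦X⟧))
      (PowerSeries.coeff l (↑(L.map fun z => factor (b z) (v z)).prod : A⟦X⟧)) := by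
  -- the two factors are evaluated at the two independent central variables of `A⟦X⟧⟦X⟧`
  let α : A⟦X⟧ →+* A⟦X⟧⟦X⟧ := PowerSeries.C
  let β : A⟦X⟧ →+* A⟦X⟧⟦X⟧ := PowerSeries.map PowerSeries.C
  have hαβ (a : A) : α (PowerSeries.C a) = β (PowerSeries.C a) := (PowerSeries.map_C _ _).symm
  let s : Subring.center A⟦X⟧⟦X⟧ := ⟨α PowerSeries.X, Subring.mem_center_iff.2 fun F => by
    ext n : 1
    rw [PowerSeries.coeff_mul_C, PowerSeries.coeff_C_mul]
    exact (PowerSeries.commute_X _).eq⟩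
  let t : Subring.center A⟦X⟧⟦X⟧ := ⟨β PowerSeries.X, Subring.mem_center_iff.2 fun F => by
    rw [PowerSeries.map_X]
    exact (PowerSeries.commute_X _).eq⟩
  have hcomm := (hv.map (α.comp PowerSeries.C)).commute_prod
    (fun z => isFactor_map_factor α (s := s) rfl (b z) (v z))
    (fun z => by
      simp only [RingHom.comp_apply, hαβ]
      exact isFactor_map_factor β (s := t) rfl (b z) (v z)) hL
  let F : A⟦X⟧ˣ := (L.map fun z => factor (b z) (v z)).prod
  have hF (φ : A⟦X⟧ →+* A⟦X⟧⟦X⟧) :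
      φ F = ↑(L.map fun z => Units.map φ.toMonoidHom (factor (b z) (v z))).prod := by
    rw [show φ F = ↑(Units.map φ.toMonoidHom F) from rfl, map_list_prod, List.map_map]
    rfl
  have hαβF : Commute (PowerSeries.C (F : A⟦X⟧)) (β F) := by
    change Commute (α F) (β F)
    rw [hF, hF]
    exact congrArg Units.val hcomm
  have hcoeff := commute_C_iff.1 hαβF l
  rw [PowerSeries.coeff_map] at hcoeff
  exact (commute_C_iff.1 hcoeff.symm k).symm

end KronSeries

section KronIdeal

variable (N : ℕ)

theorem mk_kronIdeal_eq_zero {f : FreeAlg N} (hf : KronRel N f) :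
    Ideal.Quotient.mk (kronIdeal N) f = 0 :=
  Ideal.Quotient.eq_zero_iff_mem.2 (TwoSidedIdeal.mem_asIdeal.2 (TwoSidedIdeal.subset_span hf))

variable {N}

theorem isDown_iff {x y : Letter N} : IsDown x y ↔ naturalRank x = naturalRank y + 1 := by
  constructor
  · rintro (⟨a, b, hab, rfl, rfl⟩ | ⟨a, rfl, rfl⟩) <;> simp only [naturalRank, plain, barred]
    omega
  · obtain a | a := x <;> obtain b | b := y <;> intro h <;> simp only [naturalRank] at h
    · omega
    · exact Or.inl ⟨b, a, by omega, rfl, rfl⟩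
    · obtain rfl : a = b := Fin.ext (by omega)
      exact Or.inr ⟨a, rfl, rfl⟩
    · omega

theorem exists_isDown {y : Letter N} (h : 0 < naturalRank y) : ∃ x, IsDown y x := by
  obtain b | b := y
  · have hb : 0 < (b : ℕ) := by
      simpa only [naturalRank, Nat.mul_pos_iff_of_pos_left two_pos] using h
    exact ⟨barred ⟨b - 1, by omega⟩, Or.inl ⟨⟨b - 1, by omega⟩, b, by simp; omega, rfl, rfl⟩⟩
  · exact ⟨plain b, Or.inr ⟨b, rfl, rfl⟩⟩

theorem isDown_or_far {x y z : Letter N} (hxy : (naturalOrder N).lt x y)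
    (hyz : (naturalOrder N).lt y z) :
    (IsDown y x ∧ IsDown z y) ∨
      ∃ z' z'', IsDown z z' ∧ IsDown z' z'' ∧ (naturalOrder N).lt x z'' := by
  change naturalRank x < naturalRank y at hxy
  change naturalRank y < naturalRank z at hyz
  obtain ⟨z', hz'⟩ := exists_isDown (y := z) (by omega)
  have hzz' := isDown_iff.1 hz'
  obtain ⟨z'', hz''⟩ := exists_isDown (y := z') (by omega)
  have hz'z'' := isDown_iff.1 hz''
  by_cases h : naturalRank x < naturalRank z''
  · exact Or.inr ⟨z', z'', hz', hz'', h⟩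
  · exact Or.inl ⟨isDown_iff.2 (by omega), isDown_iff.2 (by omega)⟩

variable (N)

theorem kronRelations_kronIdeal : KronRelations (naturalOrder N).lt IsBarred
    fun z => Ideal.Quotient.mk (kronIdeal N) (word [z]) := by
  have hword₂ (x y : Letter N) : word [x, y] = word [x] * word [y] := word_append [x] [y]
  have hword₃ (x y z : Letter N) : word [x, y, z] = word [x] * word [y] * word [z] := by
    rw [← hword₂, ← word_append]
    rfl
  have hrel {f g : FreeAlg N} (h : KronRel N (f - g)) :
      Ideal.Quotient.mk (kronIdeal N) f = Ideal.Quotient.mk (kronIdeal N) g := by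
    rw [← sub_eq_zero, ← map_sub]
    exact mk_kronIdeal_eq_zero N h
  constructor
  · intro x y hxy hy
    have h := hrel (.yyx x y (isPlain_iff_not_isBarred.2 hy) hxy)
    simp only [hword₃, map_mul] at h
    rw [Ring.lie_def, mul_sub, ← mul_assoc, ← mul_assoc, h, sub_self]
  · intro x y hxy hy
    have h := hrel (.xyy x y hy hxy)
    simp only [hword₃, map_mul] at h
    rw [Ring.lie_def, sub_mul, h, sub_self]
  · intro y z hyz hy
    have h := hrel (.zyy z y (isPlain_iff_not_isBarred.2 hy) hyz)
    simp only [hword₃, map_mul] at h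
    rw [Ring.lie_def, sub_mul, h, sub_self]
  · intro y z hyz hy
    have h := hrel (.yyz z y hy hyz)
    simp only [hword₃, map_mul] at h
    rw [Ring.lie_def, mul_sub, ← mul_assoc, ← mul_assoc, h, sub_self]
  · intro x y z hxy hyz
    obtain ⟨hyx, hzy⟩ | ⟨z', z'', hz', hz'', hx⟩ := isDown_or_far hxy hyz
    · have h := hrel (.rotate x y z hyx hzy)
      simp only [hword₂, map_mul, map_sub] at h
      exact h.symm
    · have h := hrel (.far x z z' z'' hz' hz'' hx)
      simp only [hword₂, map_mul] at h
      rw [Ring.lie_def, h, sub_self]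
      exact Commute.zero_right _

theorem elemCommute_kronIdeal : ElemCommute (naturalOrder N) (kronIdeal N) := by
  have hL := List.pairwise_reverse.2 (pairwise_letters (naturalOrder N))
  intro k l
  simpa only [← mk_map_elem, PowerSeries.coeff_mk] using
    (kronRelations_kronIdeal N).commute_coeff hL k l

end KronIdeal

/-! ### The Cauchy product -/

section InVariable

variable {σ A : Type*} [Ring A]

open scoped Classical in
/-- The power series `f` in the variable `x_j`, as a power series in several variables. -/
noncomputable def inVariable (j : σ) (f : A⟦X⟧) : MvPowerSeries σ A :=
  fun m => if m = Finsupp.single j (m j) then PowerSeries.coeff (m j) f else 0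

variable {j : σ} {f g : A⟦X⟧} {m : σ →₀ ℕ}

theorem coeff_inVariable_single (k : ℕ) :
    MvPowerSeries.coeff (Finsupp.single j k) (inVariable j f) = PowerSeries.coeff k f := by
  classical
  exact (if_pos (by rw [Finsupp.single_eq_same])).trans (by rw [Finsupp.single_eq_same])

theorem coeff_inVariable_of_ne (hm : m ≠ Finsupp.single j (m j)) :
    MvPowerSeries.coeff m (inVariable j f) = 0 :=
  if_neg hm

open Finset.HasAntidiagonal in
theorem coeff_mul_inVariable (G : MvPowerSeries σ A) :
    MvPowerSeries.coeff m (G * inVariable j f) =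
      ∑ p ∈ antidiagonal (m j),
        MvPowerSeries.coeff (m.erase j + Finsupp.single j p.1) G * PowerSeries.coeff p.2 f := by
  classical
  rw [MvPowerSeries.coeff_mul]
  refine (Finset.sum_of_injOn (fun p : ℕ × ℕ => (m.erase j + .single j p.1, .single j p.2))
    (fun p _ q _ h => ?_) (fun p hp => ?_) (fun ⟨a, b⟩ hab hne => ?_) fun p _ => ?_).symm
  · exact Prod.ext (Finsupp.single_injective j (add_left_cancel (Prod.ext_iff.1 h).1))
      (Finsupp.single_injective j (Prod.ext_iff.1 h).2)
  · rw [Finset.mem_coe, mem_antidiagonal] at hp ⊢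
    rw [add_assoc, ← Finsupp.single_add, hp, Finsupp.erase_add_single]
  · rw [coeff_inVariable_single]
  · rw [mem_antidiagonal] at hab
    subst hab
    refine (congrArg _ (coeff_inVariable_of_ne fun hb => hne ⟨(a j, b j), by simp, ?_⟩)).trans
      (mul_zero _)
    have hb' : b = .single j (b j) := hb
    have herase : (a + b).erase j = a.erase j := by
      rw [Finsupp.erase_add, hb', Finsupp.erase_single, add_zero]
    refine Prod.ext ?_ hb.symm
    change (a + b).erase j + .single j (a j) = a
    rw [herase, Finsupp.erase_add_single]

theorem inVariable_mul : inVariable j (f * g) = inVariable j f * inVariable j g := by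
  ext m
  rw [coeff_mul_inVariable]
  by_cases hm : m.erase j = 0
  · have hm' : m = .single j (m j) := by rw [← Finsupp.erase_add_single j m, hm]; simp
    rw [hm', coeff_inVariable_single, PowerSeries.coeff_mul]
    simp [coeff_inVariable_single]
  · rw [coeff_inVariable_of_ne, Finset.sum_eq_zero]
    · intro p _
      rw [coeff_inVariable_of_ne, zero_mul]
      intro h
      exact hm (by simpa using congrArg (Finsupp.erase j) h)
    · intro h
      exact hm (by rw [h, Finsupp.erase_single])

theorem inVariable_oneAddMulX (a : A) :
    inVariable j (oneAddMulX a : A⟦X⟧) = 1 + MvPowerSeries.C a * MvPowerSeries.X j := by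
  classical
  ext m
  rw [map_add, MvPowerSeries.coeff_one, MvPowerSeries.coeff_C_mul, MvPowerSeries.coeff_X,
    oneAddMulX, Units.val_mk]
  by_cases hm : m = .single j (m j)
  · rw [hm, coeff_inVariable_single, map_add, PowerSeries.coeff_one, PowerSeries.coeff_C_mul,
      PowerSeries.coeff_X]
    simp [(Finsupp.single_injective j).eq_iff]
  · rw [coeff_inVariable_of_ne hm, if_neg, if_neg, mul_zero, add_zero]
    · rintro rfl
      exact hm (by rw [Finsupp.single_eq_same])
    · rintro rfl
      exact hm (by simp)

theorem inVariable_one : inVariable j (1 : A⟦X⟧) = 1 := by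
  simpa [oneAddMulX] using inVariable_oneAddMulX (j := j) (0 : A)

theorem inVariable_list_prod (L : List A⟦X⟧) :
    inVariable j L.prod = (L.map (inVariable j)).prod := by
  induction L with
  | nil => exact inVariable_one
  | cons f L ih => rw [List.prod_cons, inVariable_mul, ih, List.map_cons, List.prod_cons]

open scoped Classical in
theorem coeff_prod_inVariable (f : σ → A⟦X⟧) {L : List σ} (hL : L.Nodup) (m : σ →₀ ℕ) :
    MvPowerSeries.coeff m (L.map fun j => inVariable j (f j)).prod =
      if ∀ j ∈ m.support, j ∈ L then (L.map fun j => PowerSeries.coeff (m j) (f j)).prod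
      else 0 := by
  induction L using List.reverseRecOn generalizing m with
  | nil => simp [MvPowerSeries.coeff_one, Finsupp.ext_iff]
  | append_singleton L j ih =>
    have hj : j ∉ L := fun h => (List.nodup_append.1 hL).2.2 j h j (List.mem_singleton_self j) rfl
    have hprod : (L.map fun i => PowerSeries.coeff (m.erase j i) (f i)).prod =
        (L.map fun i => PowerSeries.coeff (m i) (f i)).prod := by
      refine congrArg List.prod (List.map_congr_left fun i hi => ?_)
      rw [Finsupp.erase_ne (ne_of_mem_of_not_mem hi hj)]
    rw [List.map_append, List.map_singleton, List.prod_append, List.prod_singleton,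
      coeff_mul_inVariable, Finset.sum_eq_single (0, m j)]
    · rw [Finsupp.single_zero, add_zero, ih hL.of_append_left, hprod, ite_mul, zero_mul,
        List.map_append, List.map_singleton, List.prod_append, List.prod_singleton]
      refine if_congr ?_ rfl rfl
      simp only [Finsupp.support_erase, Finset.mem_erase, List.mem_append, List.mem_singleton]
      grind
    · intro p hp hne
      have hp1 : p.1 ≠ 0 := by
        intro h
        rw [Finset.HasAntidiagonal.mem_antidiagonal, h, zero_add] at hp
        exact hne (Prod.ext h hp)
      rw [ih hL.of_append_left, if_neg, zero_mul]
      exact fun h => hj (h j (by simpa using hp1))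
    · exact fun h => absurd (by simp) h

end InVariable

section Cauchy

variable {N : ℕ} (o : ShuffleOrder N)

theorem cauchyFactor_eq_inVariable (z : Letter N) (j : ℕ) :
    cauchyFactor z j = inVariable j (factor (IsPlain z) (word [z]) : (FreeAlg N)⟦X⟧) := by
  rw [cauchyFactor]
  split_ifs with hz
  · rw [factor, if_neg (isBarred_iff_not_isPlain.1 hz), inVariable_oneAddMulX]
  · rw [factor, if_pos (isPlain_iff_not_isBarred.2 hz)]
    refine left_inv_eq_right_inv (MvPowerSeries.invOfUnit_mul _ _ (by simp)) ?_
    rw [sub_eq_add_neg, ← neg_mul, ← map_neg, ← inVariable_oneAddMulX, ← inVariable_mul,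
      Units.mul_inv, inVariable_one]

theorem cauchyPartial_eq (n : ℕ) : cauchyPartial o n =
    ((List.range n).map fun j => inVariable j (homSeries o : (FreeAlg N)⟦X⟧)).prod := by
  rw [cauchyPartial]
  refine congrArg List.prod (List.map_congr_left fun j _ => ?_)
  rw [homSeries, ← Units.coeHom_apply, map_list_prod, inVariable_list_prod, List.map_map,
    List.map_map]
  exact congrArg List.prod (List.map_congr_left fun z _ => cauchyFactor_eq_inVariable z j)

theorem lt_bound {m : ℕ →₀ ℕ} {j : ℕ} (hj : j ∈ m.support) : j < bound m :=
  Nat.lt_succ_of_le (Finset.le_sup (f := id) hj)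

theorem prod_range_hom {m : ℕ →₀ ℕ} {n : ℕ} (hn : bound m ≤ n) :
    ((List.range n).map fun j => hom o (m j)).prod = homComposition o m := by
  induction n, hn using Nat.le_induction with
  | base => rfl
  | succ n hn ih =>
    have hm : m n = 0 := by
      by_contra h
      exact (lt_bound (Finsupp.mem_support_iff.2 h)).not_ge hn
    rw [List.range_succ, List.map_append, List.map_singleton, List.prod_append, ih,
      List.prod_singleton, hm, hom_zero, mul_one]

theorem coeff_cauchyPartial {m : ℕ →₀ ℕ} {n : ℕ} (hn : bound m ≤ n) :
    MvPowerSeries.coeff m (cauchyPartial o n) = homComposition o m := by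
  classical
  rw [cauchyPartial_eq, coeff_prod_inVariable _ List.nodup_range, if_pos, ← prod_range_hom o hn]
  · simp only [← mk_hom, PowerSeries.coeff_mk]
  · exact fun j hj => List.mem_range.2 ((lt_bound hj).trans_le hn)

theorem coeff_cauchy (m : ℕ →₀ ℕ) :
    MvPowerSeries.coeff m (cauchy o) = homComposition o m :=
  coeff_cauchyPartial o le_rfl

theorem eventually_coeff_cauchyPartial (m : ℕ →₀ ℕ) : ∀ᶠ n in Filter.atTop,
    MvPowerSeries.coeff m (cauchyPartial o n) = MvPowerSeries.coeff m (cauchy o) := by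
  filter_upwards [Filter.eventually_ge_atTop (bound m)] with n hn
  rw [coeff_cauchy, coeff_cauchyPartial o hn]

theorem hasFormalSum_monomial :
    HasFormalSum (fun α : ℕ →₀ ℕ => MvPowerSeries.monomial α (homComposition o α))
      (cauchy o) := by
  classical
  intro m
  have hne (α : ℕ →₀ ℕ) (hα : α ≠ m) :
      MvPowerSeries.coeff m (MvPowerSeries.monomial α (homComposition o α)) = 0 :=
    MvPowerSeries.coeff_monomial_ne hα.symm _
  refine ⟨(Set.finite_singleton m).subset fun α hα => not_imp_comm.1 (hne α) hα, ?_⟩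
  rw [finsum_eq_single _ m hne, MvPowerSeries.coeff_monomial_same, coeff_cauchy]

end Cauchy

/-! ### Expansion into words -/

section Words

variable {N : ℕ} (o : ShuffleOrder N)

/-- The weakly increasing sequence in `0, …, n - 1` in which `j` occurs `m j` times. -/
def sortedSeq (m : ℕ → ℕ) (n : ℕ) : List ℕ :=
  (List.range n).flatMap fun j => List.replicate (m j) j

theorem sortedSeq_succ (m : ℕ → ℕ) (n : ℕ) :
    sortedSeq m (n + 1) = sortedSeq m n ++ List.replicate (m n) n := by
  simp [sortedSeq, List.range_succ]

theorem lt_of_mem_sortedSeq {m : ℕ → ℕ} {n a : ℕ} (h : a ∈ sortedSeq m n) : a < n := by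
  simp only [sortedSeq, List.mem_flatMap, List.mem_range, List.mem_replicate] at h
  omega

theorem sortedSeq_pairwise (m : ℕ → ℕ) (n : ℕ) : (sortedSeq m n).Pairwise (· ≤ ·) := by
  induction n with
  | zero => exact List.Pairwise.nil
  | succ n ih =>
    rw [sortedSeq_succ, List.pairwise_append]
    refine ⟨ih, List.pairwise_replicate.2 (Or.inr le_rfl), fun a ha b hb => ?_⟩
    rw [List.eq_of_mem_replicate hb]
    exact (lt_of_mem_sortedSeq ha).le

theorem coe_sortedSeq (m : ℕ →₀ ℕ) :
    (sortedSeq m (bound m) : Multiset ℕ) = Finsupp.toMultiset m := by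
  have hsum (n : ℕ) : (sortedSeq m n : Multiset ℕ) = ∑ j ∈ Finset.range n, m j • {j} := by
    induction n with
    | zero => simp [sortedSeq]
    | succ n ih =>
      rw [sortedSeq_succ, ← Multiset.coe_add, ih, Finset.sum_range_succ,
        Multiset.nsmul_singleton, Multiset.coe_replicate]
  rw [hsum, Finsupp.toMultiset_apply, Finsupp.sum_of_support_subset _ _ _ (by simp)]
  exact fun j hj => Finset.mem_range.2 (lt_bound hj)

/-- The relation between consecutive pairs of a variable `x_j` and a letter in a term of the Cauchy
product. -/
abbrev PairStep : ℕ × Letter N → ℕ × Letter N → Prop :=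
  Prod.Lex (· < ·) (Step (fun a b => o.lt a b) IsPlain)

theorem isChain_zip_sortedSeq_succ (m : ℕ → ℕ) (n : ℕ) {v w : List (Letter N)}
    (hv : v.length = (sortedSeq m n).length) (hw : w.length = m n) :
    ((sortedSeq m (n + 1)).zip (v ++ w)).IsChain (PairStep o) ↔
      ((sortedSeq m n).zip v).IsChain (PairStep o) ∧
        w.IsChain (Step (fun a b => o.lt a b) IsPlain) := by
  have hzip : (List.replicate (m n) n).zip w = w.map (Prod.mk n) :=
    List.ext_getElem (by simp [hw]) (by simp)
  have hlex (x y : Letter N) : PairStep o (n, x) (n, y) ↔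
      Step (fun a b => o.lt a b) IsPlain x y := by simp [Prod.lex_iff]
  simp only [List.isChain_iff_pairwise]
  rw [sortedSeq_succ, List.zip_append hv.symm, hzip, List.pairwise_append, List.pairwise_map]
  simp only [hlex]
  refine and_congr_right fun _ => and_iff_left fun a ha b hb => ?_
  obtain ⟨x, -, rfl⟩ := List.mem_map.1 hb
  exact Prod.lex_iff.2 (Or.inl (lt_of_mem_sortedSeq (List.of_mem_zip ha).1))

theorem prod_hom_eq_wordSum (m : ℕ → ℕ) (n : ℕ) :
    ((List.range n).map fun j => hom o (m j)).prod =
      wordSum (fun z => word [z]) (fun w => ((sortedSeq m n).zip w).IsChain (PairStep o))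
        (sortedSeq m n).length := by
  induction n with
  | zero => exact (wordSum_zero _ (P := fun w => (List.zip [] w).IsChain _) List.isChain_nil).symm
  | succ n ih =>
    have hlen : (sortedSeq m (n + 1)).length = (sortedSeq m n).length + m n := by
      rw [sortedSeq_succ, List.length_append, List.length_replicate]
    rw [List.range_succ, List.map_append, List.map_singleton, List.prod_append,
      List.prod_singleton, ih, hom_eq_wordSum, wordSum_mul_wordSum, hlen]
    refine wordSum_congr _ fun w hw => ?_
    rw [← isChain_zip_sortedSeq_succ o m n (by simp [hw]) (by simp [hw]), List.take_append_drop]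

open scoped Classical in
theorem coeff_word (v w : List (Letter N)) :
    (word v).coeff (FreeMonoid.ofList w) = if v = w then 1 else 0 := by
  rw [word, MonoidAlgebra.of_apply, MonoidAlgebra.coeff_single, Finsupp.single_apply]
  exact if_congr FreeMonoid.ofList.injective.eq_iff rfl rfl

open scoped Classical in
theorem coeff_wordSum (P : List (Letter N) → Prop) (k : ℕ) (w : List (Letter N)) :
    (wordSum (fun z => word [z]) P k).coeff (FreeMonoid.ofList w) =
      if w.length = k ∧ P w then 1 else 0 := by
  simp only [wordSum, prod_map_word, MonoidAlgebra.coeff_sum, Finsupp.finsetSum_apply,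
    apply_ite MonoidAlgebra.coeff, apply_ite (fun f : FreeMonoid (Letter N) →₀ ℤ => f (.ofList w)),
    MonoidAlgebra.coeff_zero, Finsupp.zero_apply, coeff_word]
  by_cases hw : w.length = k
  · subst hw
    rw [Finset.sum_eq_single w.get]
    · simp
    · intro z _ hz
      have : List.ofFn z ≠ w := fun h => hz (List.ofFn_injective (by rw [h, List.ofFn_get]))
      simp [this]
    · simp
  · rw [if_neg fun h => hw h.1]
    refine Finset.sum_eq_zero fun z _ => ?_
    have : List.ofFn z ≠ w := fun h => hw (by rw [← h, List.length_ofFn])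
    simp [this]

theorem mem_descents_iff {w : List (Letter N)} {j : ℕ} (hj : j + 1 < w.length) :
    j ∈ descents o w ↔ ¬Step (fun a b => o.lt a b) IsPlain w[j] w[j + 1] := by
  let _ := o.toLinearOrder
  have hdesc : j ∈ descents o w ↔ w[j + 1] < w[j] ∨ (w[j] = w[j + 1] ∧ IsBarred w[j]) :=
    ⟨fun ⟨_, h⟩ => h, fun h => ⟨hj, h⟩⟩
  have hstep : Step (fun a b => o.lt a b) IsPlain w[j] w[j + 1] ↔
    (w[j] < w[j + 1] ∨ (w[j] = w[j + 1] ∧ IsPlain w[j])) := Iff.rfl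
  rw [hdesc, hstep, isBarred_iff_not_isPlain]
  rcases lt_trichotomy w[j] w[j + 1] with h | h | h
  · simp [h, h.not_gt, h.ne]
  · simp [h]
  · simp [h, h.not_gt, h.ne']

theorem forall_descents_lt_iff {w : List (Letter N)} {i : Fin w.length → ℕ} (hi : Monotone i) :
    (∀ (j : ℕ) (hj : j + 1 < w.length), j ∈ descents o w → i ⟨j, by omega⟩ < i ⟨j + 1, hj⟩) ↔
      ((List.ofFn i).zip w).IsChain (PairStep o) := by
  rw [List.isChain_iff_getElem]
  simp only [List.getElem_zip, List.getElem_ofFn, List.length_zip, List.length_ofFn, min_self,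
    Prod.lex_iff]
  refine forall₂_congr fun j hj => ?_
  have hle : i ⟨j, by omega⟩ ≤ i ⟨j + 1, hj⟩ := hi (by simp)
  rw [mem_descents_iff o hj]
  grind

theorem monotone_and_sum_single_eq_iff {t : ℕ} {m : ℕ →₀ ℕ} {i : Fin t → ℕ} :
    (Monotone i ∧ ∑ j, Finsupp.single (i j) 1 = m) ↔ List.ofFn i = sortedSeq m (bound m) := by
  have hsum : Finsupp.toMultiset (∑ j, Finsupp.single (i j) 1) = (List.ofFn i : Multiset ℕ) := by
    rw [map_sum, ← Fin.univ_val_map, ← Multiset.sum_map_singleton (Multiset.map i _),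
      Multiset.map_map]
    simp [Finset.sum]
  have hinj := Function.LeftInverse.injective (Finsupp.toMultiset_toFinsupp (α := ℕ))
  rw [← hinj.eq_iff, hsum, ← coe_sortedSeq, Multiset.coe_eq_coe]
  refine ⟨fun ⟨hi, hperm⟩ => ?_, fun h => ⟨?_, h ▸ List.Perm.refl _⟩⟩
  · exact hperm.eq_of_pairwise' hi.sortedLE_ofFn.pairwise (sortedSeq_pairwise m _)
  · exact List.sortedLE_ofFn_iff.1 (h ▸ (sortedSeq_pairwise m _).sortedLE)

open scoped Classical in
theorem coeff_wordQSym (m : ℕ →₀ ℕ) (w : List (Letter N)) :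
    MvPowerSeries.coeff m (wordQSym o w) =
      if w.length = (sortedSeq m (bound m)).length ∧
        ((sortedSeq m (bound m)).zip w).IsChain (PairStep o) then 1 else 0 := by
  change (Set.ncard {i : Fin w.length → ℕ | Monotone i ∧
    (∀ (j : ℕ) (hj : j + 1 < w.length), j ∈ descents o w → i ⟨j, by omega⟩ < i ⟨j + 1, hj⟩) ∧
    ∑ j, Finsupp.single (i j) 1 = m} : ℤ) = _
  have hmem (i : Fin w.length → ℕ) : (Monotone i ∧ (∀ (j : ℕ) (hj : j + 1 < w.length),
      j ∈ descents o w → i ⟨j, by omega⟩ < i ⟨j + 1, hj⟩) ∧ ∑ j, Finsupp.single (i j) 1 = m) ↔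
      List.ofFn i = sortedSeq m (bound m) ∧
        ((sortedSeq m (bound m)).zip w).IsChain (PairStep o) := by
    rw [← monotone_and_sum_single_eq_iff, and_left_comm, and_comm, and_assoc, and_assoc]
    refine and_congr_right fun hi => and_congr_right fun hm => ?_
    rw [forall_descents_lt_iff o hi, monotone_and_sum_single_eq_iff.1 ⟨hi, hm⟩]
  simp only [hmem]
  generalize sortedSeq m (bound m) = s
  by_cases hs : w.length = s.length ∧ (s.zip w).IsChain (PairStep o)
  · have hofFn : List.ofFn (fun j => s.get (Fin.cast hs.1 j)) = s :=
      List.ext_getElem (by simp [hs.1]) (by simp)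
    rw [if_pos hs, Nat.cast_eq_one, Set.ncard_eq_one]
    refine ⟨_, Set.eq_singleton_iff_unique_mem.2 ⟨⟨hofFn, hs.2⟩, fun i hi => ?_⟩⟩
    exact List.ofFn_injective (hi.1.trans hofFn.symm)
  · rw [if_neg hs, Nat.cast_eq_zero, ← Set.ncard_empty]
    refine congrArg Set.ncard (Set.eq_empty_iff_forall_notMem.2 fun i hi => hs ⟨?_, hi.2⟩)
    rw [← hi.1, List.length_ofFn]

theorem coeff_homComposition (m : ℕ →₀ ℕ) (w : List (Letter N)) :
    (homComposition o m).coeff (FreeMonoid.ofList w) = MvPowerSeries.coeff m (wordQSym o w) := by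
  rw [homComposition, prod_hom_eq_wordSum, coeff_wordSum, coeff_wordQSym]
  congr

theorem hasFormalSum_wordQSym :
    HasFormalSum (fun w : List (Letter N) => seriesMul (wordQSym o w) (word w)) (cauchy o) := by
  intro m
  have hcoeff (w : List (Letter N)) : MvPowerSeries.coeff m (seriesMul (wordQSym o w) (word w)) =
      (homComposition o m).coeff (FreeMonoid.ofList w) • word w := by
    rw [coeff_homComposition]
    rfl
  simp only [hcoeff, coeff_cauchy]
  generalize homComposition o m = f
  have hsupp : (Function.support fun w => f.coeff (FreeMonoid.ofList w) • (word w : FreeAlg N)) ⊆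
      f.coeff.support.map FreeMonoid.toList.toEmbedding := fun w hw => by
    rw [Finset.mem_coe, Finset.mem_map_equiv, Finsupp.mem_support_iff]
    exact left_ne_zero_of_smul hw
  refine ⟨(Finset.finite_toSet _).subset hsupp, ?_⟩
  rw [finsum_eq_sum_of_support_subset _ hsupp, Finset.sum_map]
  refine Eq.trans (Finset.sum_congr rfl fun w _ => ?_) f.sum_coeff_single
  simp [word]

end Words

section Pairing

variable {N : ℕ} (o : ShuffleOrder N)

theorem pairing_eq_sum_right (f g : FreeAlg N) :
    pairing f g = g.coeff.sum fun w a => f.coeff w * a := by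
  classical
  rw [pairing, Finsupp.sum_of_support_subset f.coeff
      (Finset.subset_union_left (s₂ := g.coeff.support)) _ (by simp),
    Finsupp.sum_of_support_subset g.coeff
      (Finset.subset_union_right (s₁ := f.coeff.support)) _ (by simp)]

/-- The pairing with a fixed element on the right, as an additive map. -/
noncomputable def pairingHom (g : FreeAlg N) : FreeAlg N →+ ℤ where
  toFun f := pairing f g
  map_zero' := by simp [pairing]
  map_add' f f' := by
    simp only [pairing_eq_sum_right, MonoidAlgebra.coeff_add, Finsupp.add_apply, add_mul]
    exact Finsupp.sum_add

theorem coeff_F (γ : FreeAlg N) (m : ℕ →₀ ℕ) :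
    MvPowerSeries.coeff m (F o γ) = pairing (homComposition o m) γ := by
  rw [pairing_eq_sum_right, F, Finsupp.sum, Finsupp.sum, map_sum]
  refine Finset.sum_congr rfl fun w _ => ?_
  rw [map_zsmul, ← coeff_homComposition, FreeMonoid.ofList_toList, smul_eq_mul, mul_comm]

end Pairing

/-! ### Dual Jacobi–Trudi determinants -/

section Determinants

variable {C : Type*} [CommRing C]

theorem det_eq_sum_prod_apply {n : ℕ} (A : Matrix (Fin n) (Fin n) C) :
    A.det = ∑ π : Equiv.Perm (Fin n), ((Equiv.Perm.sign π : ℤ) : C) * ∏ i, A i (π i) := by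
  rw [← Matrix.det_transpose, Matrix.det_apply']
  rfl

theorem sum_powersetCard_det_shift_row {n : ℕ} (k : ℕ) (f : Fin n → ℕ → C) :
    ∑ S ∈ Finset.powersetCard k (Finset.univ : Finset (Fin n)),
        (Matrix.of fun i j : Fin n => f i (j + if i ∈ S then 1 else 0)).det =
      ∑ S ∈ Finset.powersetCard k (Finset.univ : Finset (Fin n)),
        (Matrix.of fun i j : Fin n => f i (j + if j ∈ S then 1 else 0)).det := by
  simp only [det_eq_sum_prod_apply]
  rw [Finset.sum_comm, Finset.sum_comm (s := Finset.powersetCard k Finset.univ)]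
  refine Finset.sum_congr rfl fun π _ => Finset.sum_equiv π.finsetCongr (fun S => ?_) fun S _ => ?_
  · simp [Finset.mem_powersetCard]
  · simp [Equiv.finsetCongr]

theorem card_filter_sub_le {n k : ℕ} (hk : k ≤ n) :
    (Finset.univ.filter fun j : Fin n => n - k ≤ (j : ℕ)).card = k := by
  have h := Finset.card_filter_add_card_filter_not (s := Finset.univ)
    (fun j : Fin n => (j : ℕ) < n - k)
  simp only [not_lt, Fin.card_filter_val_lt, Finset.card_univ, Fintype.card_fin] at h
  omega

theorem eq_filter_sub_le_of_succ_mem {n : ℕ} {S : Finset (Fin n)}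
    (hS : ∀ i ∈ S, ∀ j : Fin n, (j : ℕ) = i + 1 → j ∈ S) :
    S = Finset.univ.filter fun j : Fin n => n - S.card ≤ (j : ℕ) := by
  have hupper : IsUpperSet (S : Set (Fin n)) := by
    refine fun i j hij hi => ?_
    obtain ⟨d, hd⟩ := Nat.exists_eq_add_of_le (Fin.le_def.1 hij)
    induction d generalizing j with
    | zero => rwa [show j = i from Fin.ext hd]
    | succ d ih =>
      have hlt : (i : ℕ) + d < n := by have := j.2; omega
      exact hS ⟨i + d, hlt⟩ (ih (j := ⟨i + d, hlt⟩) (Fin.le_def.2 (Nat.le_add_right _ _)) rfl) j hd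
  have hfilter : IsUpperSet
      ((Finset.univ.filter fun j : Fin n => n - S.card ≤ (j : ℕ) : Finset (Fin n)) :
        Set (Fin n)) := by
    intro i j hij hi
    simp only [Finset.coe_filter, Finset.mem_univ, true_and, Set.mem_ofPred_eq] at hi ⊢
    exact hi.trans hij
  have hcard := card_filter_sub_le (n := n) (k := S.card) (by simpa using S.card_le_univ)
  rcases hupper.total hfilter with h | h
  · exact Finset.eq_of_subset_of_card_le (Finset.coe_subset.1 h) hcard.le
  · exact (Finset.eq_of_subset_of_card_le (Finset.coe_subset.1 h) hcard.ge).symm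

theorem sum_powersetCard_det_shift_col {n k : ℕ} (hk : k ≤ n) (f : Fin n → ℕ → C) :
    ∑ S ∈ Finset.powersetCard k (Finset.univ : Finset (Fin n)),
        (Matrix.of fun i j : Fin n => f i (j + if j ∈ S then 1 else 0)).det =
      (Matrix.of fun i j : Fin n => f i (j + if n - k ≤ (j : ℕ) then 1 else 0)).det := by
  rw [Finset.sum_eq_single (Finset.univ.filter fun j : Fin n => n - k ≤ (j : ℕ))]
  · simp
  · intro S hS hne
    obtain ⟨-, rfl⟩ := Finset.mem_powersetCard.1 hS
    obtain ⟨i, hi, j, hij, hj⟩ : ∃ i ∈ S, ∃ j : Fin n, (j : ℕ) = i + 1 ∧ j ∉ S := by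
      by_contra! h
      exact hne (eq_filter_sub_le_of_succ_mem h)
    refine Matrix.det_zero_of_column_eq (i := i) (j := j) (fun h => by simp [h] at hij) fun l => ?_
    simp [hi, hj, hij]
  · intro h
    exact absurd (Finset.mem_powersetCard.2 ⟨Finset.subset_univ _, card_filter_sub_le hk⟩) h

/-- The entry `e_{p-q}` of a Toeplitz matrix, where `e_k = 0` for `k < 0`. -/
def toeplitzEntry (e : ℕ → C) (p q : ℕ) : C := if q ≤ p then e (p - q) else 0

theorem toeplitzEntry_of_lt (e : ℕ → C) {p q : ℕ} (h : p < q) : toeplitzEntry e p q = 0 :=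
  if_neg h.not_ge

theorem toeplitzEntry_add_left (e : ℕ → C) (p q : ℕ) : toeplitzEntry e (q + p) q = e p := by
  simp [toeplitzEntry]

/-- The dual Jacobi–Trudi determinant of the matrix of the `e_{a_i + j - i}`, for a sequence `a`
of column lengths. -/
def colDet {n : ℕ} (e : ℕ → C) (a : Fin n → ℕ) : C :=
  (Matrix.of fun i j : Fin n => toeplitzEntry e (a i + j) i).det

theorem det_toeplitz_shift_eq_mul {e : ℕ → C} {a : ℕ → ℕ} {T : ℕ} (ha : ∀ i, T ≤ i → a i = 0)
    (k δ : ℕ) :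
    (Matrix.of fun i j : Fin (T + k) =>
        toeplitzEntry e (a i + (j + if T ≤ (j : ℕ) then δ else 0)) i).det =
      colDet e (fun i : Fin T => a i) * colDet e (fun _ : Fin k => δ) := by
  rw [← Matrix.det_submatrix_equiv_self (finSumFinEquiv (m := T) (n := k)), colDet, colDet,
    ← Matrix.det_fromBlocks_zero₂₁ _ (Matrix.of fun (i : Fin T) (j : Fin k) =>
      toeplitzEntry e (a i + (T + j + δ)) i)]
  congr 1
  ext (i | i) (j | j)
  · simp [j.2.not_ge]
  · simp
  · have hj : (j : ℕ) < T + i := j.2.trans_le (Nat.le_add_right _ _)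
    simp [ha, j.2.not_ge, toeplitzEntry_of_lt e hj]
  · simp [ha, toeplitzEntry, add_assoc, add_comm δ, Nat.add_sub_add_left]

theorem colDet_zero {e : ℕ → C} (he : e 0 = 1) (n : ℕ) : colDet e (fun _ : Fin n => 0) = 1 := by
  rw [colDet, Matrix.det_of_isUpperTriangular]
  · exact Finset.prod_eq_one fun i _ => by simp [toeplitzEntry, he]
  · intro i j hij
    have hij : (j : ℕ) < i := hij
    simp [toeplitzEntry_of_lt e hij]

theorem colDet_eq_of_le {e : ℕ → C} (he : e 0 = 1) {a : ℕ → ℕ} {T n : ℕ}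
    (ha : ∀ i, T ≤ i → a i = 0) (hn : T ≤ n) :
    colDet e (fun i : Fin n => a i) = colDet e (fun i : Fin T => a i) := by
  obtain ⟨k, rfl⟩ := Nat.exists_eq_add_of_le hn
  have hmul := det_toeplitz_shift_eq_mul (e := e) ha k 0
  simp only [colDet_zero he, mul_one, ite_self, add_zero] at hmul
  exact hmul

/-- The upper triangular Toeplitz matrix of the coefficients of a power series. -/
noncomputable def toeplitz (n : ℕ) (E : C⟦X⟧) : Matrix (Fin n) (Fin n) C :=
  Matrix.of fun i j => toeplitzEntry (fun k => E.coeff k) j i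

theorem toeplitz_one (n : ℕ) : toeplitz n (1 : C⟦X⟧) = 1 := by
  ext i j
  simp only [toeplitz, toeplitzEntry, Matrix.of_apply, PowerSeries.coeff_one, Matrix.one_apply,
    Fin.ext_iff]
  grind

theorem toeplitz_mul (n : ℕ) (E G : C⟦X⟧) : toeplitz n (E * G) = toeplitz n E * toeplitz n G := by
  ext i j
  simp only [toeplitz, Matrix.mul_apply, Matrix.of_apply]
  rcases lt_or_ge j i with hji | hij
  · rw [toeplitzEntry_of_lt _ hji]
    refine (Finset.sum_eq_zero fun l _ => ?_).symm
    rcases lt_or_ge l i with hl | hl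
    · rw [toeplitzEntry_of_lt _ hl, zero_mul]
    · rw [toeplitzEntry_of_lt _ (hji.trans_le hl), mul_zero]
  · obtain ⟨d, hd⟩ := Nat.exists_eq_add_of_le (Fin.le_def.1 hij)
    rw [hd, toeplitzEntry_add_left, PowerSeries.coeff_mul,
      Fin.sum_univ_eq_sum_range (fun l => toeplitzEntry (fun k => E.coeff k) l i *
        toeplitzEntry (fun k => G.coeff k) (i + d) l) n]
    refine Finset.sum_of_injOn (fun p => i + p.1) ?_ ?_ ?_ ?_
    · intro p hp q hq h
      simp only [Finset.mem_coe, Finset.HasAntidiagonal.mem_antidiagonal] at hp hq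
      exact Prod.ext (by simp at h; omega) (by simp at h; omega)
    · intro p hp
      simp only [Finset.mem_coe, Finset.HasAntidiagonal.mem_antidiagonal] at hp
      simp only [Finset.coe_range, Set.mem_Iio]
      omega
    · intro l _ hl
      rcases lt_or_ge l i with hli | hil
      · rw [toeplitzEntry_of_lt _ hli, zero_mul]
      · have hdl : i + d < l := by
          by_contra hld
          refine hl ⟨(l - i, i + d - l), ?_, Nat.add_sub_cancel' hil⟩
          simp only [Finset.mem_coe, Finset.HasAntidiagonal.mem_antidiagonal]
          omega
        rw [toeplitzEntry_of_lt _ hdl, mul_zero]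
    · intro p hp
      rw [Finset.HasAntidiagonal.mem_antidiagonal] at hp
      rw [toeplitzEntry_add_left, ← hp, ← add_assoc, toeplitzEntry_add_left]

variable {e h : ℕ → C}

theorem colDet_one (he : e 0 = 1)
    (heh : PowerSeries.mk e * PowerSeries.mk (fun k => (-1) ^ k * h k) = 1) (k : ℕ) :
    colDet e (fun _ : Fin k => 1) = h k := by
  set A := toeplitz (k + 1) (PowerSeries.mk e)
  set B := toeplitz (k + 1) (PowerSeries.mk fun k => (-1) ^ k * h k)
  have hdet : A.det = 1 := by
    simpa [A, toeplitz, colDet] using colDet_zero he (k + 1)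
  have hAB : A * B = 1 := by rw [← toeplitz_mul, heh, toeplitz_one]
  have hadj : A.adjugate = B := by
    rw [← mul_one A.adjugate, ← hAB, ← mul_assoc, Matrix.adjugate_mul, hdet, one_smul, one_mul]
  have hminor : A.submatrix (Fin.last k).succAbove (Fin.succAbove 0) =
      Matrix.of fun i j : Fin k => toeplitzEntry e (1 + j) i := by
    ext i j
    simp [A, toeplitz, add_comm]
  have hcorner := Matrix.adjugate_fin_succ_eq_det_submatrix A 0 (Fin.last k)
  rw [hadj, hminor, ← colDet] at hcorner
  simp only [B, toeplitz, toeplitzEntry, Matrix.of_apply, Fin.val_zero, Fin.val_last, Nat.zero_le,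
    if_true, Nat.sub_zero, PowerSeries.coeff_mk, add_zero] at hcorner
  exact ((isUnit_neg_one.pow k).mul_left_cancel hcorner).symm

theorem mul_colDet (he : e 0 = 1)
    (heh : PowerSeries.mk e * PowerSeries.mk (fun k => (-1) ^ k * h k) = 1)
    {a : ℕ → ℕ} {T : ℕ} (ha : ∀ i, T ≤ i → a i = 0) (k : ℕ) :
    h k * colDet e (fun i : Fin T => a i) =
      ∑ S ∈ Finset.powersetCard k (Finset.univ : Finset (Fin (T + k))),
        colDet e (fun i => a i + if i ∈ S then 1 else 0) := by
  rw [mul_comm, ← colDet_one he heh k, ← det_toeplitz_shift_eq_mul ha k 1]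
  let f (i : Fin (T + k)) (c : ℕ) : C := toeplitzEntry e (a i + c) i
  have hcol := sum_powersetCard_det_shift_col (Nat.le_add_left k T) f
  rw [Nat.add_sub_cancel, ← sum_powersetCard_det_shift_row] at hcol
  simp only [colDet, add_assoc, add_comm (ite _ _ _)]
  exact hcol.symm

theorem colDet_add_indicator_eq_zero {a : ℕ → ℕ} {n : ℕ} {S : Finset (Fin n)} {i j : Fin n}
    (hij : (j : ℕ) = i + 1) (ha : a j = a i) (hi : i ∉ S) (hj : j ∈ S) :
    colDet e (fun i => a i + if i ∈ S then 1 else 0) = 0 := by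
  refine Matrix.det_zero_of_row_eq (i := i) (j := j) (fun h => by simp [h] at hij) ?_
  funext l
  simp only [Matrix.of_apply, if_neg hi, if_pos hj, toeplitzEntry]
  grind

end Determinants

/-! ### The Pieri rule -/

section Strips

theorem colLen_eq_zero {ν : YoungDiagram} {j : ℕ} (hj : ν.rowLen 0 ≤ j) : ν.colLen j = 0 := by
  by_contra h
  have hmem : (0, j) ∈ ν := YoungDiagram.mem_iff_lt_colLen.2 (Nat.pos_of_ne_zero h)
  exact (YoungDiagram.mem_iff_lt_rowLen.1 hmem).not_ge hj

theorem rowLen_zero_le_of_colLen_eq_zero {ν : YoungDiagram} {n : ℕ} (hn : ν.colLen n = 0) :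
    ν.rowLen 0 ≤ n := by
  by_contra! hlt
  have hmem := YoungDiagram.mem_iff_lt_colLen.1 (YoungDiagram.mem_iff_lt_rowLen.2 hlt)
  omega

theorem rowLen_zero_le_card (ν : YoungDiagram) : ν.rowLen 0 ≤ ν.card := by
  rw [YoungDiagram.rowLen_eq_card]
  exact Finset.card_le_card (Finset.filter_subset _ _)

theorem colLen_zero_le_card (ν : YoungDiagram) : ν.colLen 0 ≤ ν.card := by
  rw [YoungDiagram.colLen_eq_card]
  exact Finset.card_le_card (Finset.filter_subset _ _)

theorem card_eq_sum_colLen {ν : YoungDiagram} {n : ℕ} (hn : ν.rowLen 0 ≤ n) :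
    ν.card = ∑ j : Fin n, ν.colLen j := by
  rw [← Finset.sum_range (fun j => ν.colLen j), YoungDiagram.card,
    Finset.card_eq_sum_card_fiberwise (f := Prod.snd) (t := Finset.range n)]
  · exact Finset.sum_congr rfl fun j _ => (YoungDiagram.colLen_eq_card ν).symm
  · rintro ⟨i, j⟩ hc
    rw [Finset.mem_coe, Finset.mem_range]
    by_contra! hj
    have hlt := YoungDiagram.mem_iff_lt_colLen.1 ((YoungDiagram.mem_cells _).1 hc)
    rw [colLen_eq_zero (hn.trans hj)] at hlt
    omega

theorem ext_colLen {μ ν : YoungDiagram} (h : ∀ j, μ.colLen j = ν.colLen j) : μ = ν := by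
  ext ⟨i, j⟩
  rw [YoungDiagram.mem_cells, YoungDiagram.mem_cells, YoungDiagram.mem_iff_lt_colLen,
    YoungDiagram.mem_iff_lt_colLen, h]

theorem finite_card_eq (d : ℕ) : {ν : YoungDiagram | ν.card = d}.Finite := by
  have hinj : Set.InjOn YoungDiagram.cells {ν : YoungDiagram | ν.card = d} :=
    fun μ _ ν _ h => YoungDiagram.ext h
  refine Set.Finite.of_injOn (t := (Finset.range d ×ˢ Finset.range d).powerset) ?_ hinj
    (Finset.finite_toSet _)
  rintro ν rfl
  rw [Finset.mem_coe, Finset.mem_powerset]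
  rintro ⟨i, j⟩ hc
  rw [YoungDiagram.mem_cells] at hc
  have hi := YoungDiagram.mem_iff_lt_colLen.1 (ν.up_left_mem le_rfl (Nat.zero_le j) hc)
  have hj := YoungDiagram.mem_iff_lt_rowLen.1 (ν.up_left_mem (Nat.zero_le i) le_rfl hc)
  exact Finset.mem_product.2 ⟨Finset.mem_range.2 (hi.trans_le (colLen_zero_le_card ν)),
    Finset.mem_range.2 (hj.trans_le (rowLen_zero_le_card ν))⟩

/-- The partitions of `d`. -/
noncomputable def diagrams (d : ℕ) : Finset YoungDiagram := (finite_card_eq d).toFinset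

theorem mem_diagrams {ν : YoungDiagram} {d : ℕ} : ν ∈ diagrams d ↔ ν.card = d :=
  Set.Finite.mem_toFinset _

/-- The Young diagram with given column lengths, supported on the first `n` columns. -/
def ofColLen (f : ℕ → ℕ) (hf : Antitone f) (n : ℕ) : YoungDiagram where
  cells := (Finset.range (f 0) ×ˢ Finset.range n).filter fun c => c.1 < f c.2
  isLowerSet := by
    rintro ⟨i, j⟩ ⟨i', j'⟩ ⟨hi, hj⟩ h
    simp only [Finset.coe_filter, Finset.mem_product, Finset.mem_range, Set.mem_ofPred_eq] at h ⊢
    simp only at hi hj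
    have := hf hj
    omega

theorem colLen_ofColLen {f : ℕ → ℕ} (hf : Antitone f) {n : ℕ} (hn : f n = 0) (j : ℕ) :
    (ofColLen f hf n).colLen j = f j := by
  refine eq_of_forall_lt_iff fun i => ?_
  rw [← YoungDiagram.mem_iff_lt_colLen, ← YoungDiagram.mem_cells]
  simp only [ofColLen, Finset.mem_filter, Finset.mem_product, Finset.mem_range]
  refine ⟨fun h => h.2, fun h => ⟨⟨h.trans_le (hf (Nat.zero_le j)), ?_⟩, h⟩⟩
  by_contra! hj
  have := hf hj
  omega

/-- `ν / μ` is a horizontal strip. -/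
def IsHorizontalStrip (μ ν : YoungDiagram) : Prop :=
  ∀ j, μ.colLen j ≤ ν.colLen j ∧ ν.colLen j ≤ μ.colLen j + 1

theorem IsHorizontalStrip.le {μ ν : YoungDiagram} (h : IsHorizontalStrip μ ν) : μ ≤ ν := by
  rintro ⟨i, j⟩ hc
  exact YoungDiagram.mem_iff_lt_colLen.2 ((YoungDiagram.mem_iff_lt_colLen.1 hc).trans_le (h j).1)

/-- The columns containing a cell of `ν / μ`, among the first `n`. -/
def stripColumns (μ ν : YoungDiagram) (n : ℕ) : Finset (Fin n) :=
  Finset.univ.filter fun j => μ.colLen j < ν.colLen j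

theorem IsHorizontalStrip.colLen_eq {μ ν : YoungDiagram} (h : IsHorizontalStrip μ ν) {n : ℕ}
    (j : Fin n) : ν.colLen j = μ.colLen j + if j ∈ stripColumns μ ν n then 1 else 0 := by
  have := h j
  simp only [stripColumns, Finset.mem_filter, Finset.mem_univ, true_and]
  split_ifs <;> omega

theorem IsHorizontalStrip.card_eq {μ ν : YoungDiagram} (h : IsHorizontalStrip μ ν) {n : ℕ}
    (hμ : μ.rowLen 0 ≤ n) (hν : ν.rowLen 0 ≤ n) :
    ν.card = μ.card + (stripColumns μ ν n).card := by
  rw [card_eq_sum_colLen hμ, card_eq_sum_colLen hν, Finset.sum_congr rfl fun j _ => h.colLen_eq j,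
    Finset.sum_add_distrib]
  simp

theorem stripColumns_injOn (μ : YoungDiagram) (n : ℕ) :
    Set.InjOn (fun ν => stripColumns μ ν n) {ν | IsHorizontalStrip μ ν ∧ ν.rowLen 0 ≤ n} := by
  rintro ν ⟨hν, hn⟩ ν' ⟨hν', hn'⟩ (h : stripColumns μ ν n = stripColumns μ ν' n)
  refine ext_colLen fun j => ?_
  rcases lt_or_ge j n with hj | hj
  · exact (hν.colLen_eq ⟨j, hj⟩).trans (h ▸ (hν'.colLen_eq ⟨j, hj⟩).symm)
  · rw [colLen_eq_zero (hn.trans hj), colLen_eq_zero (hn'.trans hj)]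

theorem exists_stripColumns_eq {μ : YoungDiagram} {n : ℕ} (hμ : μ.rowLen 0 ≤ n)
    {S : Finset (Fin n)}
    (hS : ∀ i j : Fin n, (j : ℕ) = i + 1 → μ.colLen j = μ.colLen i → j ∈ S → i ∈ S) :
    ∃ ν, IsHorizontalStrip μ ν ∧ ν.rowLen 0 ≤ n ∧ stripColumns μ ν n = S := by
  let f : ℕ → ℕ := fun j => μ.colLen j + if ∃ h : j < n, ⟨j, h⟩ ∈ S then 1 else 0
  have hf : Antitone f := by
    refine antitone_nat_of_succ_le fun j => ?_
    have hanti := YoungDiagram.colLen_anti μ j (j + 1) (Nat.le_succ j)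
    simp only [f]
    split_ifs with hj hi
    · omega
    · obtain ⟨hlt, hmem⟩ := hj
      have hne : μ.colLen (j + 1) ≠ μ.colLen j := fun heq =>
        hi ⟨by omega, hS ⟨j, by omega⟩ ⟨j + 1, hlt⟩ rfl heq hmem⟩
      omega
    · omega
    · omega
  have hfn : f n = 0 := by simp [f, colLen_eq_zero hμ]
  have hcol := colLen_ofColLen hf hfn
  refine ⟨ofColLen f hf n, fun j => ?_, rowLen_zero_le_of_colLen_eq_zero ((hcol n).trans hfn), ?_⟩
  · rw [hcol]
    simp only [f]
    split_ifs <;> omega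
  · ext j
    by_cases hj : j ∈ S <;> simp [stripColumns, hcol, f, hj]

variable {C : Type*} [CommRing C] {e h : ℕ → C}

/-- The dual Jacobi–Trudi determinant of a Young diagram, in a commutative ring. -/
def schurDet (e : ℕ → C) (ν : YoungDiagram) : C := colDet e fun i : Fin (ν.rowLen 0) => ν.colLen i

theorem schurDet_eq (he : e 0 = 1) {ν : YoungDiagram} {n : ℕ} (hn : ν.rowLen 0 ≤ n) :
    schurDet e ν = colDet e fun i : Fin n => ν.colLen i :=
  (colDet_eq_of_le he (fun _ => colLen_eq_zero) hn).symm

open scoped Classical in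
theorem mul_schurDet (he : e 0 = 1)
    (heh : PowerSeries.mk e * PowerSeries.mk (fun k => (-1) ^ k * h k) = 1)
    (μ : YoungDiagram) (k : ℕ) :
    h k * schurDet e μ =
      ∑ ν ∈ diagrams (μ.card + k) with IsHorizontalStrip μ ν, schurDet e ν := by
  set n := μ.card + k
  have hμ : μ.rowLen 0 ≤ n := (rowLen_zero_le_card μ).trans (Nat.le_add_right _ _)
  have hrow {ν : YoungDiagram} (hν : ν.card = n) : ν.rowLen 0 ≤ n := hν ▸ rowLen_zero_le_card ν
  rw [schurDet_eq he (rowLen_zero_le_card μ), mul_colDet he heh fun i hi =>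
    colLen_eq_zero ((rowLen_zero_le_card μ).trans hi)]
  symm
  refine Finset.sum_of_injOn (fun ν => stripColumns μ ν n) ?_ ?_ ?_ ?_
  · refine (stripColumns_injOn μ n).mono fun ν hν => ?_
    simp only [Finset.coe_filter, mem_diagrams, Set.mem_ofPred_eq] at hν
    exact ⟨hν.2, hrow hν.1⟩
  · intro ν hν
    simp only [Finset.coe_filter, mem_diagrams, Set.mem_ofPred_eq] at hν
    have hcard := hν.2.card_eq hμ (hrow hν.1)
    exact Finset.mem_powersetCard.2 ⟨Finset.subset_univ _, by simp only; omega⟩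
  · intro S hS hS'
    by_cases hgood : ∀ i j : Fin n, (j : ℕ) = i + 1 → μ.colLen j = μ.colLen i → j ∈ S → i ∈ S
    · obtain ⟨ν, hν, hn, rfl⟩ := exists_stripColumns_eq hμ hgood
      refine absurd ⟨ν, ?_, rfl⟩ hS'
      rw [Finset.mem_coe, Finset.mem_filter, mem_diagrams, hν.card_eq hμ hn,
        (Finset.mem_powersetCard.1 hS).2]
      exact ⟨rfl, hν⟩
    · push Not at hgood
      obtain ⟨i, j, hij, heq, hj, hi⟩ := hgood
      exact colDet_add_indicator_eq_zero hij heq hi hj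
  · intro ν hν
    rw [Finset.mem_filter, mem_diagrams] at hν
    rw [schurDet_eq he (hrow hν.1), funext hν.2.colLen_eq]

end Strips

/-! ### Kostka numbers -/

section Tableaux

variable {μ ν : YoungDiagram}

theorem content_apply (T : SemistandardYoungTableau ν) (a : ℕ) :
    content T a = (ν.cells.filter fun c => T c.1 c.2 = a).card := by
  rw [content, Finsupp.finsetSum_apply, Finset.card_filter]
  exact Finset.sum_congr rfl fun c _ => Finsupp.single_apply

theorem degree_content (T : SemistandardYoungTableau ν) : (content T).degree = ν.card := by
  simp [content, YoungDiagram.card]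

theorem entry_mem_support {T : SemistandardYoungTableau ν} {c : ℕ × ℕ} (hc : c ∈ ν) :
    T c.1 c.2 ∈ (content T).support := by
  rw [Finsupp.mem_support_iff, content_apply]
  exact (Finset.card_pos.2 ⟨c, by simp [hc]⟩).ne'

theorem finite_content (m : ℕ →₀ ℕ) :
    {T : SemistandardYoungTableau ν | content T = m}.Finite := by
  have hlt {T : SemistandardYoungTableau ν} (hT : content T = m) {i j : ℕ} (hc : (i, j) ∈ ν) :
      T i j < m.support.sup id + 1 := lt_bound (hT ▸ entry_mem_support hc)
  refine Set.Finite.of_injOn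
    (f := fun T (c : ν.cells) => Fin.ofNat (m.support.sup id + 1) (T c.1.1 c.1.2))
    (Set.mapsTo_univ _ _) ?_ Set.finite_univ
  intro T hT T' hT' h
  ext i j
  by_cases hc : (i, j) ∈ ν
  · have hmod := congrArg Fin.val (congrFun h ⟨(i, j), (YoungDiagram.mem_cells _).2 hc⟩)
    simp only [Fin.ofNat] at hmod
    rwa [Nat.mod_eq_of_lt (hlt hT hc), Nat.mod_eq_of_lt (hlt hT' hc)] at hmod
  · rw [T.zeros hc, T'.zeros hc]

/-- The Kostka number: the number of semistandard tableaux of given shape and content. -/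
noncomputable def kostka (ν : YoungDiagram) (m : ℕ →₀ ℕ) : ℕ :=
  Set.ncard {T : SemistandardYoungTableau ν | content T = m}

theorem card_eq_of_kostka_ne_zero {m : ℕ →₀ ℕ} (h : kostka ν m ≠ 0) : ν.card = m.degree := by
  obtain ⟨T, hT⟩ := Set.nonempty_of_ncard_ne_zero h
  rw [← degree_content T, hT]

theorem kostka_bot_zero : kostka ⊥ 0 = 1 := by
  refine Set.ncard_eq_one.2 ⟨default, Set.eq_singleton_iff_unique_mem.2 ⟨?_, fun T _ => ?_⟩⟩
  · simp [content]
  · ext i j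
    rw [T.zeros (YoungDiagram.notMem_bot _), SemistandardYoungTableau.zeros _
      (YoungDiagram.notMem_bot _)]

/-- The diagram of the cells with entry less than `n`. -/
def cellsBelow (T : SemistandardYoungTableau ν) (n : ℕ) : YoungDiagram where
  cells := ν.cells.filter fun c => T c.1 c.2 < n
  isLowerSet := by
    rintro ⟨i, j⟩ ⟨i', j'⟩ ⟨hi, hj⟩ h
    simp only [Finset.coe_filter, YoungDiagram.mem_cells, Set.mem_ofPred_eq] at h ⊢
    simp only at hi hj
    refine ⟨ν.up_left_mem hi hj h.1, lt_of_le_of_lt ?_ h.2⟩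
    exact (T.row_weak_of_le hj (ν.up_left_mem hi le_rfl h.1)).trans (T.col_weak hi h.1)

theorem mem_cellsBelow {T : SemistandardYoungTableau ν} {n : ℕ} {c : ℕ × ℕ} :
    c ∈ cellsBelow T n ↔ c ∈ ν ∧ T c.1 c.2 < n := by
  rw [← YoungDiagram.mem_cells, cellsBelow, Finset.mem_filter, YoungDiagram.mem_cells]

theorem isHorizontalStrip_cellsBelow {T : SemistandardYoungTableau ν} {n : ℕ}
    (hT : ∀ c ∈ ν, T c.1 c.2 ≤ n) : IsHorizontalStrip (cellsBelow T n) ν := by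
  refine fun j => ⟨?_, ?_⟩
  · by_contra! hlt
    have hmem := (mem_cellsBelow.1 (YoungDiagram.mem_iff_lt_colLen.2 hlt)).1
    exact (YoungDiagram.mem_iff_lt_colLen.1 hmem).false
  · by_contra! hlt
    have hmem : ((cellsBelow T n).colLen j + 1, j) ∈ ν := YoungDiagram.mem_iff_lt_colLen.2 hlt
    have hentry := (T.col_strict (Nat.lt_add_one _) hmem).trans_le (hT _ hmem)
    have hbelow : ((cellsBelow T n).colLen j, j) ∈ cellsBelow T n :=
      mem_cellsBelow.2 ⟨ν.up_left_mem (Nat.le_succ _) le_rfl hmem, hentry⟩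
    exact (YoungDiagram.mem_iff_lt_colLen.1 hbelow).false

/-- The restriction of a tableau to a smaller diagram. -/
def restrict (T : SemistandardYoungTableau ν) (h : μ ≤ ν) : SemistandardYoungTableau μ where
  entry i j := if (i, j) ∈ μ then T i j else 0
  row_weak' {i j1 j2} hj hc := by
    rw [if_pos hc, if_pos (μ.up_left_mem le_rfl hj.le hc)]
    exact T.row_weak hj (h hc)
  col_strict' {i1 i2 j} hi hc := by
    rw [if_pos hc, if_pos (μ.up_left_mem hi.le le_rfl hc)]
    exact T.col_strict hi (h hc)
  zeros' hc := if_neg hc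

theorem restrict_apply (T : SemistandardYoungTableau ν) (h : μ ≤ ν) (i j : ℕ) :
    restrict T h i j = if (i, j) ∈ μ then T i j else 0 := rfl

theorem restrict_cellsBelow_lt {T : SemistandardYoungTableau ν} {n : ℕ} (h : cellsBelow T n ≤ ν) :
    ∀ c ∈ cellsBelow T n, restrict T h c.1 c.2 < n := by
  intro c hc
  rw [restrict_apply, if_pos hc]
  exact (mem_cellsBelow.1 hc).2

/-- The extension of a tableau by the entry `n` in a horizontal strip. -/
def extend (T : SemistandardYoungTableau μ) (h : IsHorizontalStrip μ ν) {n : ℕ}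
    (hT : ∀ c ∈ μ, T c.1 c.2 < n) : SemistandardYoungTableau ν where
  entry i j := if (i, j) ∈ μ then T i j else if (i, j) ∈ ν then n else 0
  row_weak' {i j1 j2} hj hc := by
    by_cases h2 : (i, j2) ∈ μ
    · rw [if_pos h2, if_pos (μ.up_left_mem le_rfl hj.le h2)]
      exact T.row_weak hj h2
    · rw [if_neg h2, if_pos hc]
      split_ifs with h1
      · exact (hT _ h1).le
      · exact le_rfl
      · exact Nat.zero_le _
  col_strict' {i1 i2 j} hi hc := by
    by_cases h2 : (i2, j) ∈ μ
    · rw [if_pos h2, if_pos (μ.up_left_mem hi.le le_rfl h2)]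
      exact T.col_strict hi h2
    · have h1 : (i1, j) ∈ μ := by
        rw [YoungDiagram.mem_iff_lt_colLen] at hc ⊢
        have := (h j).2
        omega
      rw [if_neg h2, if_pos hc, if_pos h1]
      exact hT _ h1
  zeros' {i j} hc := by
    rw [if_neg fun h' => hc (h.le h'), if_neg hc]

theorem extend_apply (T : SemistandardYoungTableau μ) (h : IsHorizontalStrip μ ν) {n : ℕ}
    (hT : ∀ c ∈ μ, T c.1 c.2 < n) (i j : ℕ) :
    extend T h hT i j = if (i, j) ∈ μ then T i j else if (i, j) ∈ ν then n else 0 := rfl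

theorem restrict_extend (T : SemistandardYoungTableau μ) (h : IsHorizontalStrip μ ν) {n : ℕ}
    (hT : ∀ c ∈ μ, T c.1 c.2 < n) : restrict (extend T h hT) h.le = T := by
  ext i j
  rw [restrict_apply, extend_apply]
  by_cases hc : (i, j) ∈ μ
  · rw [if_pos hc, if_pos hc]
  · rw [if_neg hc, T.zeros hc]

theorem extend_restrict_cellsBelow {T : SemistandardYoungTableau ν} {n : ℕ}
    (hT : ∀ c ∈ ν, T c.1 c.2 ≤ n) (h : IsHorizontalStrip (cellsBelow T n) ν) :
    extend (restrict T h.le) h (restrict_cellsBelow_lt h.le) = T := by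
  ext i j
  rw [extend_apply, restrict_apply]
  split_ifs with hbelow hν
  · rfl
  · refine ((hT _ hν).antisymm (not_lt.1 fun hlt => hbelow ?_)).symm
    exact mem_cellsBelow.2 ⟨hν, hlt⟩
  · exact (T.zeros hν).symm

theorem cellsBelow_extend (T : SemistandardYoungTableau μ) (h : IsHorizontalStrip μ ν) {n : ℕ}
    (hT : ∀ c ∈ μ, T c.1 c.2 < n) : cellsBelow (extend T h hT) n = μ := by
  ext c
  rw [YoungDiagram.mem_cells, YoungDiagram.mem_cells, mem_cellsBelow, extend_apply]
  refine ⟨fun ⟨hν, hlt⟩ => ?_, fun hμ => ⟨h.le hμ, ?_⟩⟩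
  · by_contra hμ
    rw [if_neg hμ, if_pos hν] at hlt
    exact hlt.false
  · rw [if_pos hμ]
    exact hT c hμ

theorem content_extend (T : SemistandardYoungTableau μ) (h : IsHorizontalStrip μ ν) {n : ℕ}
    (hT : ∀ c ∈ μ, T c.1 c.2 < n) :
    content (extend T h hT) = content T + Finsupp.single n (ν.card - μ.card) := by
  have hsub : μ.cells ⊆ ν.cells := YoungDiagram.cells_subset_iff.2 h.le
  rw [content, ← Finset.sum_sdiff hsub, add_comm, content, YoungDiagram.card, YoungDiagram.card,
    ← Finset.card_sdiff_of_subset hsub]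
  congr 1
  · refine Finset.sum_congr rfl fun c hc => ?_
    rw [extend_apply, if_pos ((YoungDiagram.mem_cells _).1 hc)]
  · have hstrip : ∀ c ∈ ν.cells \ μ.cells,
        Finsupp.single (extend T h hT c.1 c.2) 1 = Finsupp.single n 1 := by
      intro c hc
      rw [Finset.mem_sdiff, YoungDiagram.mem_cells, YoungDiagram.mem_cells] at hc
      rw [extend_apply, if_neg hc.2, if_pos hc.1]
    rw [Finset.sum_congr rfl hstrip, Finset.sum_const, Finsupp.smul_single_one]

theorem entry_le_of_content_eq {T : SemistandardYoungTableau ν} {f : ℕ →₀ ℕ} {n k : ℕ}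
    (hf : ∀ a ∈ f.support, a < n) (hT : content T = f + Finsupp.single n k) :
    ∀ c ∈ ν, T c.1 c.2 ≤ n := by
  intro c hc
  rcases Finset.mem_union.1 (Finsupp.support_add (hT ▸ entry_mem_support hc)) with h | h
  · exact (hf _ h).le
  · exact (Finset.mem_singleton.1 (Finsupp.support_single_subset h)).le

theorem content_restrict_cellsBelow {T : SemistandardYoungTableau ν} {f : ℕ →₀ ℕ} {n k : ℕ}
    (hf : ∀ a ∈ f.support, a < n) (hT : content T = f + Finsupp.single n k)
    (h : IsHorizontalStrip (cellsBelow T n) ν) : content (restrict T h.le) = f := by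
  have hsplit := content_extend (restrict T h.le) h (restrict_cellsBelow_lt h.le)
  rw [extend_restrict_cellsBelow (entry_le_of_content_eq hf hT), hT] at hsplit
  have hfn : f n = 0 := by_contra fun hn => (hf n (Finsupp.mem_support_iff.2 hn)).false
  have hrn : content (restrict T h.le) n = 0 := by
    rw [content_apply, Finset.card_eq_zero, Finset.filter_eq_empty_iff]
    exact fun c hc => (restrict_cellsBelow_lt h.le c ((YoungDiagram.mem_cells _).1 hc)).ne
  have hk := DFunLike.congr_fun hsplit n
  simp only [Finsupp.add_apply, Finsupp.single_eq_same, hfn, hrn, zero_add] at hk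
  rw [← hk] at hsplit
  exact (add_right_cancel hsplit).symm

theorem ncard_content_eq_cellsBelow_eq {f : ℕ →₀ ℕ} {n k : ℕ} (hf : ∀ a ∈ f.support, a < n)
    (h : IsHorizontalStrip μ ν) (hcard : ν.card = μ.card + k) :
    Set.ncard {T : SemistandardYoungTableau ν |
        content T = f + Finsupp.single n k ∧ cellsBelow T n = μ} = kostka μ f := by
  have hlt {T : SemistandardYoungTableau μ} (hT : content T = f) : ∀ c ∈ μ, T c.1 c.2 < n :=
    fun c hc => hf _ (hT ▸ entry_mem_support hc)
  symm
  refine Set.ncard_congr (fun T hT => extend T h (hlt hT)) ?_ ?_ ?_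
  · intro T hT
    refine ⟨?_, cellsBelow_extend T h _⟩
    rw [content_extend, hcard, Nat.add_sub_cancel_left, show content T = f from hT]
  · intro T T' hT hT' heq
    rw [← restrict_extend T h (hlt hT), heq, restrict_extend]
  · rintro T ⟨hT, rfl⟩
    exact ⟨restrict T h.le, content_restrict_cellsBelow hf hT h,
      extend_restrict_cellsBelow (entry_le_of_content_eq hf hT) h⟩

open scoped Classical in
theorem kostka_add_single {f : ℕ →₀ ℕ} {n k : ℕ} (hf : ∀ a ∈ f.support, a < n)
    (hν : ν.card = f.degree + k) :
    kostka ν (f + Finsupp.single n k) =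
      ∑ μ ∈ diagrams f.degree with IsHorizontalStrip μ ν, kostka μ f := by
  rw [kostka, Set.ncard_eq_toFinset_card _ (finite_content _),
    Finset.card_eq_sum_card_fiberwise (f := fun T => cellsBelow T n)
      (t := {μ ∈ diagrams f.degree | IsHorizontalStrip μ ν})]
  · refine Finset.sum_congr rfl fun μ hμ => ?_
    rw [Finset.mem_filter, mem_diagrams] at hμ
    rw [← ncard_content_eq_cellsBelow_eq hf hμ.2 (hμ.1 ▸ hν), ← Set.ncard_coe_finset]
    congr 1
    ext T
    simp
  · intro T hT
    rw [Set.Finite.coe_toFinset] at hT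
    have hstrip := isHorizontalStrip_cellsBelow (entry_le_of_content_eq hf hT)
    rw [Finset.mem_coe, Finset.mem_filter, mem_diagrams, ← content_restrict_cellsBelow hf hT hstrip,
      degree_content]
    exact ⟨rfl, hstrip⟩

variable {C : Type*} [CommRing C] {e h : ℕ → C}

theorem prod_eq_sum_kostka_smul_schurDet (he : e 0 = 1)
    (heh : PowerSeries.mk e * PowerSeries.mk (fun k => (-1) ^ k * h k) = 1) (m : ℕ →₀ ℕ) :
    m.prod (fun _ k => h k) = ∑ ν ∈ diagrams m.degree, kostka ν m • schurDet e ν := by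
  classical
  induction m using Finsupp.induction_on_max₂ with
  | zero =>
    have hdiag : diagrams 0 = {⊥} := by
      ext ν
      rw [mem_diagrams, Finset.mem_singleton, YoungDiagram.card, Finset.card_eq_zero,
        YoungDiagram.ext_iff, YoungDiagram.cells_bot]
    have hbot : (⊥ : YoungDiagram).rowLen 0 ≤ 0 := rowLen_zero_le_card ⊥
    rw [map_zero, hdiag, Finset.sum_singleton, kostka_bot_zero, one_smul, Finsupp.prod_zero_index,
      schurDet_eq he hbot, colDet, Matrix.det_fin_zero]
  | add_single n k f hf hk ih =>
    have hdisj : Disjoint f.support (Finsupp.single n k).support :=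
      (Finset.disjoint_singleton_right.2 fun hn => (hf n hn).false).mono_right
        Finsupp.support_single_subset
    have hsingle : (Finsupp.single n k).prod (fun _ k => h k) = h k := by
      simp [Finsupp.prod, Finsupp.support_single, hk]
    have hdeg : (f + Finsupp.single n k).degree = f.degree + k := by simp
    calc (f + Finsupp.single n k).prod (fun _ k => h k)
        = ∑ μ ∈ diagrams f.degree, kostka μ f • (h k * schurDet e μ) := by
          rw [Finsupp.prod_add_index_of_disjoint hdisj, hsingle, ih, Finset.sum_mul]
          exact Finset.sum_congr rfl fun μ _ => by rw [smul_mul_assoc, mul_comm]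
      _ = ∑ μ ∈ diagrams f.degree, ∑ ν ∈ diagrams (f.degree + k) with IsHorizontalStrip μ ν,
            kostka μ f • schurDet e ν := by
          refine Finset.sum_congr rfl fun μ hμ => ?_
          rw [mul_schurDet he heh, mem_diagrams.1 hμ, Finset.smul_sum]
      _ = ∑ ν ∈ diagrams (f.degree + k), ∑ μ ∈ diagrams f.degree with IsHorizontalStrip μ ν,
            kostka μ f • schurDet e ν :=
          Finset.sum_comm' fun μ ν => by simp only [Finset.mem_filter]; tauto
      _ = ∑ ν ∈ diagrams (f + Finsupp.single n k).degree,
            kostka ν (f + Finsupp.single n k) • schurDet e ν := by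
          rw [hdeg]
          refine Finset.sum_congr rfl fun ν hν => ?_
          rw [← Finset.sum_smul, kostka_add_single hf (mem_diagrams.1 hν)]

end Tableaux

/-! ### Expansions modulo an ideal -/

section Quotient

theorem exists_commRing_lift_of_commute.{u, v} {A : Type u} {ι : Type v} [Ring A] {a : ι → A}
    (ha : ∀ i j, Commute (a i) (a j)) :
    ∃ (C : Type u) (_ : CommRing C) (φ : C →+* A) (b : ι → C),
      Function.Injective φ ∧ ∀ i, φ (b i) = a i := by
  have hcomm : ∀ x ∈ Set.range a, ∀ y ∈ Set.range a, x * y = y * x := by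
    rintro _ ⟨i, rfl⟩ _ ⟨j, rfl⟩
    exact ha i j
  have := Subring.isMulCommutative_closure hcomm
  let _ : CommRing (Subring.closure (Set.range a)) :=
    { (inferInstance : Ring (Subring.closure (Set.range a))) with
      mul_comm := fun x y => mul_comm' x y }
  exact ⟨Subring.closure (Set.range a), inferInstance, Subring.subtype _,
    fun i => ⟨a i, Subring.subset_closure ⟨i, rfl⟩⟩, Subring.subtype_injective _, fun _ => rfl⟩

variable {N : ℕ} {o : ShuffleOrder N} {I : Ideal (FreeAlg N)} [I.IsTwoSided]

theorem exists_commRing_lift (hI : ElemCommute o I) :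
    ∃ (C : Type) (_ : CommRing C) (φ : C →+* FreeAlg N ⧸ I) (e h : ℕ → C),
      (∀ k, φ (e k) = Ideal.Quotient.mk I (elem o k)) ∧
      (∀ k, φ (h k) = Ideal.Quotient.mk I (hom o k)) ∧ e 0 = 1 ∧ h 0 = 1 ∧
      PowerSeries.mk e * PowerSeries.mk (fun k => (-1) ^ k * h k) = 1 := by
  obtain ⟨C, _, φ, e, hφ, he⟩ := exists_commRing_lift_of_commute hI
  have he0 : e 0 = 1 := hφ (by rw [he, elem_zero, map_one, map_one])
  let E : C⟦X⟧ := PowerSeries.mk fun k => (-1) ^ k * e k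
  let H : C⟦X⟧ := PowerSeries.invOfUnit E 1
  have hEH : E * H = 1 := PowerSeries.mul_invOfUnit _ _ (by simp [E, he0])
  have hE : PowerSeries.map φ E =
      PowerSeries.map (Ideal.Quotient.mk I) ↑(homSeries o)⁻¹ := by
    rw [inv_homSeries]
    ext k
    simp [E, he]
  have hH : PowerSeries.map φ H = PowerSeries.map (Ideal.Quotient.mk I) ↑(homSeries o) := by
    refine left_inv_eq_right_inv (a := PowerSeries.map φ E) ?_ ?_ |>.symm
    · rw [hE, ← map_mul, Units.mul_inv, map_one]
    · rw [← map_mul, hEH, map_one]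
  have hh (k : ℕ) : φ (PowerSeries.coeff k H) = Ideal.Quotient.mk I (hom o k) := by
    rw [← PowerSeries.coeff_map, hH, ← mk_hom, PowerSeries.coeff_map, PowerSeries.coeff_mk]
  refine ⟨C, inferInstance, φ, e, fun k => PowerSeries.coeff k H, he, hh, he0,
    hφ (by rw [hh, hom_zero, map_one, map_one]), ?_⟩
  calc PowerSeries.mk e * PowerSeries.mk (fun k => (-1) ^ k * PowerSeries.coeff k H)
      = PowerSeries.rescale (-1) (E * H) := by
        rw [map_mul, PowerSeries.rescale_mk]
        congr 1
        ext k
        simp [← mul_assoc, ← mul_pow]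
    _ = 1 := by rw [hEH, map_one]

section Lift

variable {C : Type*} [CommRing C] {φ : C →+* FreeAlg N ⧸ I} {e h : ℕ → C}

theorem map_schurDet (he : ∀ k, φ (e k) = Ideal.Quotient.mk I (elem o k)) (ν : YoungDiagram) :
    φ (schurDet e ν) = Ideal.Quotient.mk I (superSchur o ν) := by
  have hentry (p q : ℕ) : φ (toeplitzEntry e p q) =
      Ideal.Quotient.mk I (elemInt o ((p : ℤ) - (q : ℤ))) := by
    rw [toeplitzEntry, elemInt]
    split_ifs with hle hlt hlt
    · omega
    · rw [he, ← Nat.cast_sub hle, Int.toNat_natCast]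
    · rw [map_zero, map_zero]
    · omega
  rw [schurDet, colDet, det_eq_sum_prod_apply, superSchur, map_sum, map_sum]
  refine Finset.sum_congr rfl fun π _ => ?_
  rw [map_mul, map_intCast, map_zsmul, zsmul_eq_mul, ← List.prod_ofFn, map_list_prod,
    map_list_prod, List.map_ofFn, List.map_ofFn]
  congr 3
  funext i
  exact (hentry _ _).trans (by rw [Nat.cast_add, Function.comp_apply])

theorem map_finsuppProd (hh : ∀ k, φ (h k) = Ideal.Quotient.mk I (hom o k)) (h0 : h 0 = 1)
    (m : ℕ →₀ ℕ) :
    φ (m.prod fun _ k => h k) = Ideal.Quotient.mk I (homComposition o m) := by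
  have hsupp : m.support ⊆ Finset.range (bound m) := fun _ hj => Finset.mem_range.2 (lt_bound hj)
  have hprod : (m.prod fun _ k => h k) = ((List.range (bound m)).map fun j => h (m j)).prod :=
    Finsupp.prod_of_support_subset _ hsupp _ fun _ _ => h0
  rw [hprod, homComposition, map_list_prod, map_list_prod, List.map_map, List.map_map]
  exact congrArg List.prod (List.map_congr_left fun j _ => hh _)

end Lift

theorem mk_homComposition_embDomain (hI : ElemCommute o I) (σ : ℕ ↪ ℕ) (m : ℕ →₀ ℕ) :
    Ideal.Quotient.mk I (homComposition o (m.embDomain σ)) =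
      Ideal.Quotient.mk I (homComposition o m) := by
  obtain ⟨C, _, φ, e, h, -, hh, -, h0, -⟩ := exists_commRing_lift hI
  rw [← map_finsuppProd hh h0, ← map_finsuppProd hh h0, Finsupp.prod_embDomain]

theorem mk_homPartition (hI : ElemCommute o I) {ν : YoungDiagram} {m : ℕ →₀ ℕ}
    (hν : m.support.val.map m = (ν.rowLens : Multiset ℕ)) :
    Ideal.Quotient.mk I (homPartition o ν) = Ideal.Quotient.mk I (homComposition o m) := by
  obtain ⟨C, _, φ, e, h, -, hh, -, h0, -⟩ := exists_commRing_lift hI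
  have hprod : (m.prod fun _ k => h k) = (ν.rowLens.map h).prod := by
    rw [← Multiset.prod_coe, ← Multiset.map_coe, ← hν, Multiset.map_map]
    rfl
  rw [← map_finsuppProd hh h0, hprod, homPartition, map_list_prod, map_list_prod, List.map_map,
    List.map_map]
  exact congrArg List.prod (List.map_congr_left fun k _ => (hh k).symm)

theorem mk_homComposition_eq_sum (hI : ElemCommute o I) (m : ℕ →₀ ℕ) :
    Ideal.Quotient.mk I (homComposition o m) =
      Ideal.Quotient.mk I (∑ ν ∈ diagrams m.degree, kostka ν m • superSchur o ν) := by
  obtain ⟨C, _, φ, e, h, he, hh, he0, hh0, heh⟩ := exists_commRing_lift hI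
  rw [← map_finsuppProd hh hh0, prod_eq_sum_kostka_smul_schurDet he0 heh, map_sum, map_sum]
  exact Finset.sum_congr rfl fun ν _ => by rw [map_nsmul, map_nsmul, map_schurDet he]

theorem coeff_schur (ν : YoungDiagram) (m : ℕ →₀ ℕ) :
    MvPowerSeries.coeff m (schur ν) = (kostka ν m : ℤ) := rfl

theorem support_kostka_smul_subset {B : Type*} [AddCommMonoid B] (m : ℕ →₀ ℕ)
    (a : YoungDiagram → B) :
    (Function.support fun ν => kostka ν m • a ν) ⊆ diagrams m.degree := fun ν hν =>
  mem_diagrams.2 <| card_eq_of_kostka_ne_zero fun h => hν <| by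
    change kostka ν m • a ν = 0
    rw [h, zero_smul]

theorem exists_rowLens_eq {s : Multiset ℕ} (hs : 0 ∉ s) :
    ∃ ν : YoungDiagram, s = (ν.rowLens : Multiset ℕ) := by
  have hpos : ∀ x ∈ s.sort (· ≥ ·), 0 < x := fun x hx =>
    Nat.pos_of_ne_zero fun h => hs (h ▸ (Multiset.mem_sort _).1 hx)
  have hsort : (s.sort (· ≥ ·)).SortedGE := (Multiset.pairwise_sort s (· ≥ ·)).sortedGE
  refine ⟨YoungDiagram.ofRowLens _ hsort, ?_⟩
  rw [YoungDiagram.rowLens_ofRowLens_eq_self hpos, Multiset.sort_eq]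

theorem rowLens_injective {μ ν : YoungDiagram}
    (h : (μ.rowLens : Multiset ℕ) = (ν.rowLens : Multiset ℕ)) : μ = ν :=
  YoungDiagram.equivListRowLens.injective <| Subtype.ext <|
    (Multiset.coe_eq_coe.1 h).eq_of_pairwise' μ.rowLens_sorted.pairwise
      ν.rowLens_sorted.pairwise

theorem hasFormalSum_monomialSym (hI : ElemCommute o I) :
    HasFormalSum (fun ν : YoungDiagram => seriesMul (monomialSym ν)
      (Ideal.Quotient.mk I (homPartition o ν)))
      (MvPowerSeries.map (Ideal.Quotient.mk I) (cauchy o)) := by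
  classical
  intro m
  have hparts : 0 ∉ m.support.val.map m := by
    rw [Multiset.mem_map]
    rintro ⟨j, hj, hj0⟩
    exact Finsupp.mem_support_iff.1 hj hj0
  obtain ⟨ν₀, hν₀⟩ := exists_rowLens_eq hparts
  have hcoeff (ν : YoungDiagram) : MvPowerSeries.coeff m (seriesMul (monomialSym ν)
      (Ideal.Quotient.mk I (homPartition o ν))) =
      if ν = ν₀ then Ideal.Quotient.mk I (homComposition o m) else 0 := by
    change (if _ then (1 : ℤ) else 0) • Ideal.Quotient.mk I (homPartition o ν) = _
    split_ifs with hν heq heq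
    · rw [one_smul, mk_homPartition hI hν]
    · exact (heq (rowLens_injective (hν.symm.trans hν₀))).elim
    · exact (hν (heq ▸ hν₀)).elim
    · exact zero_smul _ _
  simp only [hcoeff]
  refine ⟨(Set.finite_singleton ν₀).subset fun ν hν => of_not_not fun h => hν (if_neg h), ?_⟩
  rw [finsum_eq_single _ ν₀ fun ν hν => if_neg hν, if_pos rfl, MvPowerSeries.coeff_map,
    coeff_cauchy]

theorem hasFormalSum_schur (hI : ElemCommute o I) :
    HasFormalSum (fun ν : YoungDiagram => seriesMul (schur ν)
      (Ideal.Quotient.mk I (superSchur o ν)))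
      (MvPowerSeries.map (Ideal.Quotient.mk I) (cauchy o)) := by
  intro m
  have hcoeff (ν : YoungDiagram) : MvPowerSeries.coeff m (seriesMul (schur ν)
      (Ideal.Quotient.mk I (superSchur o ν))) =
      kostka ν m • Ideal.Quotient.mk I (superSchur o ν) := natCast_zsmul _ _
  simp only [hcoeff]
  refine ⟨(Finset.finite_toSet _).subset (support_kostka_smul_subset m _), ?_⟩
  rw [finsum_eq_sum_of_support_subset _ (support_kostka_smul_subset m _),
    MvPowerSeries.coeff_map, coeff_cauchy, mk_homComposition_eq_sum hI, map_sum]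
  exact Finset.sum_congr rfl fun ν _ => (map_nsmul _ _ _).symm

theorem pairing_eq_of_mk_eq {γ : FreeAlg N} (hγ : γ ∈ perp I) {f g : FreeAlg N}
    (h : Ideal.Quotient.mk I f = Ideal.Quotient.mk I g) : pairing f γ = pairing g γ :=
  sub_eq_zero.1 ((map_sub (pairingHom γ) f g).symm.trans (hγ _ (Ideal.Quotient.eq.1 h)))

theorem isSymmetricSeries_F (hI : ElemCommute o I) {γ : FreeAlg N} (hγ : γ ∈ perp I) :
    IsSymmetricSeries (F o γ) := by
  intro σ
  ext m
  obtain ⟨m, rfl⟩ : ∃ m' : ℕ →₀ ℕ, m'.embDomain σ.toEmbedding = m := by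
    simp only [Finsupp.embDomain_eq_mapDomain]
    exact Finsupp.mapDomain_surjective σ.surjective m
  calc MvPowerSeries.coeff (m.embDomain σ.toEmbedding) (MvPowerSeries.renameEquiv ℤ σ (F o γ))
      = MvPowerSeries.coeff m (F o γ) := MvPowerSeries.coeff_embDomain_rename σ.toEmbedding _ _
    _ = MvPowerSeries.coeff (m.embDomain σ.toEmbedding) (F o γ) := by
        rw [coeff_F, coeff_F]
        exact pairing_eq_of_mk_eq hγ (mk_homComposition_embDomain hI _ _).symm

theorem hasFormalSum_F (hI : ElemCommute o I) {γ : FreeAlg N} (hγ : γ ∈ perp I) :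
    HasFormalSum (fun ν : YoungDiagram => pairing (superSchur o ν) γ • schur ν) (F o γ) := by
  intro m
  have hcoeff (ν : YoungDiagram) : MvPowerSeries.coeff m (pairing (superSchur o ν) γ • schur ν) =
      kostka ν m • pairing (superSchur o ν) γ := by
    rw [map_zsmul, coeff_schur, smul_eq_mul, nsmul_eq_mul, mul_comm]
  simp only [hcoeff]
  refine ⟨(Finset.finite_toSet _).subset (support_kostka_smul_subset m _), ?_⟩
  rw [finsum_eq_sum_of_support_subset _ (support_kostka_smul_subset m _), coeff_F,
    pairing_eq_of_mk_eq hγ (mk_homComposition_eq_sum hI m)]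
  change _ = pairingHom γ _
  rw [map_sum]
  exact Finset.sum_congr rfl fun ν _ => (map_nsmul (pairingHom γ) _ _).symm

end Quotient

end SuperSchur

theorem theorem2p3 (N : ℕ) :
    -- the case of `I_kron` and the natural order
    SuperSchur.ElemCommute (SuperSchur.naturalOrder N) (SuperSchur.kronIdeal N) ∧
    (∀ γ ∈ SuperSchur.perp (SuperSchur.kronIdeal N),
      SuperSchur.IsSymmetricSeries (SuperSchur.F (SuperSchur.naturalOrder N) γ) ∧
      SuperSchur.HasFormalSum
        (fun ν : YoungDiagram =>
          SuperSchur.pairing (SuperSchur.superSchur (SuperSchur.naturalOrder N) ν) γ •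
            SuperSchur.schur ν)
        (SuperSchur.F (SuperSchur.naturalOrder N) γ)) ∧
    -- the general case
    (∀ o : SuperSchur.ShuffleOrder N,
      -- the infinite Cauchy product converges
      (∀ m : ℕ →₀ ℕ, ∀ᶠ n in Filter.atTop,
        MvPowerSeries.coeff m (SuperSchur.cauchyPartial o n) =
          MvPowerSeries.coeff m (SuperSchur.cauchy o)) ∧
      -- its two expansions in `𝒰`
      SuperSchur.HasFormalSum
        (fun w : List (SuperSchur.Letter N) =>
          SuperSchur.seriesMul (SuperSchur.wordQSym o w) (SuperSchur.word w))
        (SuperSchur.cauchy o) ∧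
      SuperSchur.HasFormalSum
        (fun α : ℕ →₀ ℕ => MvPowerSeries.monomial α (SuperSchur.homComposition o α))
        (SuperSchur.cauchy o) ∧
      (∀ (γ : SuperSchur.FreeAlg N) (m : ℕ →₀ ℕ),
        MvPowerSeries.coeff m (SuperSchur.F o γ) =
          SuperSchur.pairing (MvPowerSeries.coeff m (SuperSchur.cauchy o)) γ) ∧
      (∀ (I : Ideal (SuperSchur.FreeAlg N)) [I.IsTwoSided],
        (SuperSchur.ElemCommute o I ↔ SuperSchur.HomCommute o I) ∧
        (SuperSchur.ElemCommute o I →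
          -- the expansions of the Cauchy product in `𝒰/I`
          SuperSchur.HasFormalSum
            (fun ν : YoungDiagram => SuperSchur.seriesMul (SuperSchur.monomialSym ν)
              (Ideal.Quotient.mk I (SuperSchur.homPartition o ν)))
            (MvPowerSeries.map (Ideal.Quotient.mk I) (SuperSchur.cauchy o)) ∧
          SuperSchur.HasFormalSum
            (fun ν : YoungDiagram => SuperSchur.seriesMul (SuperSchur.schur ν)
              (Ideal.Quotient.mk I (SuperSchur.superSchur o ν)))
            (MvPowerSeries.map (Ideal.Quotient.mk I) (SuperSchur.cauchy o)) ∧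
          (∀ γ ∈ SuperSchur.perp I,
            SuperSchur.IsSymmetricSeries (SuperSchur.F o γ) ∧
            SuperSchur.HasFormalSum
              (fun ν : YoungDiagram =>
                SuperSchur.pairing (SuperSchur.superSchur o ν) γ • SuperSchur.schur ν)
              (SuperSchur.F o γ))))) := by
  have hK := SuperSchur.elemCommute_kronIdeal N
  refine ⟨hK, fun γ hγ => ⟨SuperSchur.isSymmetricSeries_F hK hγ, SuperSchur.hasFormalSum_F hK hγ⟩,
    fun o => ⟨SuperSchur.eventually_coeff_cauchyPartial o, SuperSchur.hasFormalSum_wordQSym o,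
      SuperSchur.hasFormalSum_monomial o, fun γ m => ?_, fun I _ =>
      ⟨SuperSchur.elemCommute_iff_homCommute o I, fun hI =>
        ⟨SuperSchur.hasFormalSum_monomialSym hI, SuperSchur.hasFormalSum_schur hI, fun γ hγ =>
          ⟨SuperSchur.isSymmetricSeries_F hI hγ, SuperSchur.hasFormalSum_F hI hγ⟩⟩⟩⟩⟩
  rw [SuperSchur.coeff_F, SuperSchur.coeff_cauchy]
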